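/- Let $P\subset\mathbb R^n$ be a simple convex $n$-dimensional polytope, i.e. a bounded intersection of finitely many closed half-spaces with nonempty interior, every vertex of which lies in exactly $n$ facets. For a polytope $C$ let $\mathcal F(C)$ be its set of facets (faces of codimension one). The nerve complex $K_C$ is the simplicial complex on the vertex set $\mathcal F(C)$ whose simplices are the sets of facets with nonempty common intersection. Suppose that $P$ is flag, i.e. every minimal nonface $J$ of $K_P$ with $|J|\ge 2$ (a non-simplex all of whose proper subsets are simplices) has $|J|=2$. Let $F$ be a nonempty face of $P$. For $C\in\{F,P\}$ let $\mathcal Z_C=(T^{\mathcal F(C)}\times C)/\!\sim$ be the moment-angle manifold, where $T=S^1$ and $(t,p)\sim(s,q)$ iff $p=q$ and $t_G=s_G$ for every facet $G\not\ni p$. For a simplicial complex $K$ on a vertex set $V$ let $\mathcal Z_K=\bigcup_{\sigma\in K}\{z\in\mathbb C^V:\ |z_i|\le 1\ (i\in\sigma),\ |z_i|=1\ (i\notin\sigma)\}$ be its moment-angle-complex (the union includes $\sigma=\varnothing$). Then there is a unique map $\varphi\colon\mathcal F(F)\to\mathcal F(P)$ with $G=F\cap\varphi(G)$ for all $G\in\mathcal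 F(F)$. It induces an injective simplicial map $\Phi\colon K_F\to K_P$; a map $\hat i\colon\mathcal Z_F\to\mathcal Z_P$, $[t,p]\mapsto[\tilde\varphi(t),p]$; and a map $\hat\Phi\colon\mathcal Z_{K_F}\to\mathcal Z_{K_P}$, $z\mapsto\tilde\varphi(z)$. Here $\tilde\varphi(z)_{\varphi(G)}=z_G$, and all coordinates of $\tilde\varphi(z)$ outside the image of $\varphi$ are $1$. Moreover: 1. $\Phi(K_F)$ is the full subcomplex of $K_P$ on the vertex set $\varphi(\mathcal F(F))$. 2. There are homeomorphisms $H_1\colon\mathcal Z_F\to\mathcal Z_{K_F}$ and $H_2\colon\mathcal Z_P\to\mathcal Z_{K_P}$ with $H_2\circ\hat i=\hat\Phi\circ H_1$. 3. $\hat i$ has a retraction: there is a continuous $\rho\colon\mathcal Z_P\to\mathcal Z_F$ with $\rho\circ\hat i=\mathrm{id}$. 4. For every commutative ring $R$ with unit, the ring homomorphism $\hat i^*\colon H^*(\mathcal Z_P;R)\to H^*(\mathcal Z_F;R)$ in singular cohomology is a split epimorphism of graded rings: there is a homomorphism of graded $R$-algebras $s$ with $\hat i^*\circ s=\mathrm{id}$.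 -/

import Mathlib

noncomputable section

/-! ### Faces, facets, simple polytopes -/

section Polytopes

variable {E : Type} [NormedAddCommGroup E] [NormedSpace ℝ E]

/-- `F` is a nonempty face of the convex set `C`: the set of points of `C` at which some linear
functional attains its maximum on `C` (the zero functional gives `C` itself). -/
def IsFace (C F : Set E) : Prop :=
  F.Nonempty ∧ IsExposed ℝ C F

/-- The dimension of a set, i.e. of its affine hull. -/
def setDim (C : Set E) : ℕ :=
  Module.finrank ℝ (vectorSpan ℝ C)

/-- A facet is a nonempty face of codimension one. -/
def IsFacet (C G : Set E) : Prop :=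
  IsFace C G ∧ setDim G + 1 = setDim C

/-- The set `𝓕(C)` of facets of `C`. -/
def Facet (C : Set E) : Type :=
  {G : Set E // IsFacet C G}

instance (C : Set E) : CoeOut (Facet C) (Set E) := ⟨Subtype.val⟩

theorem Facet.subset {C : Set E} (G : Facet C) : (G : Set E) ⊆ C :=
  G.2.1.2.subset

/-- A simple convex `n`-dimensional polytope in `ℝⁿ`: a bounded intersection of finitely many
closed half-spaces, with nonempty interior, such that every vertex lies in exactly `n` facets. -/
structure IsSimplePolytope {n : ℕ} (P : Set (EuclideanSpace ℝ (Fin n))) : Prop where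
  halfspaces : ∃ (m : ℕ) (a : Fin m → EuclideanSpace ℝ (Fin n)) (b : Fin m → ℝ),
    P = {x | ∀ i, 0 ≤ inner ℝ (a i) x + b i}
  bounded : Bornology.IsBounded P
  full_dim : (interior P).Nonempty
  simple : ∀ v ∈ P.extremePoints ℝ, {G : Set (EuclideanSpace ℝ (Fin n)) | IsFacet P G ∧ v ∈ G}.encard = n

end Polytopes

/-! ### Simplicial complexes

Simplicial complexes are Mathlib's `PreAbstractSimplicialComplex`, whose simplices are the
*nonempty* members of the complex; the empty simplex always belongs to a complex and is not
recorded. -/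

section Complexes

variable {V W : Type}

/-- The full subcomplex `K_S` of `K` on the set of vertices `S`. -/
def fullSubcomplex (K : PreAbstractSimplicialComplex V) (S : Set V) :
    PreAbstractSimplicialComplex V where
  faces := {σ | σ ∈ K ∧ (σ : Set V) ⊆ S}
  isRelLowerSet_faces := by
    rintro σ ⟨hσ, hS⟩
    refine ⟨(K.isRelLowerSet_faces hσ).1, fun τ hτ hne => ⟨(K.isRelLowerSet_faces hσ).2 hτ hne, ?_⟩⟩
    exact (Finset.coe_subset.mpr hτ).trans hS

/-- The image of `K` under a map of vertices. -/
def imageComplex (φ : V → W) (K : PreAbstractSimplicialComplex V) :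
    PreAbstractSimplicialComplex W :=
  open Classical in K.map φ

/-- `J` is a minimal nonface of `K`: `|J| ≥ 2` and `K_J` is the boundary of the simplex on `J`. -/
def IsMinimalNonface (K : PreAbstractSimplicialComplex V) (J : Finset V) : Prop :=
  2 ≤ J.card ∧ ∀ τ : Finset V, τ.Nonempty → τ ⊆ J → (τ ∈ K ↔ τ ≠ J)

/-- A complex is flag if all its minimal nonfaces have two elements. -/
def IsFlagComplex (K : PreAbstractSimplicialComplex V) : Prop :=
  ∀ J : Finset V, IsMinimalNonface K J → J.card = 2

/-- `φ` is injective on vertices and maps simplices of `K` to simplices of `L`, i.e. it defines a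
nondegenerate injective simplicial map `K → L`. -/
structure IsSimplicialEmbedding (K : PreAbstractSimplicialComplex V)
    (L : PreAbstractSimplicialComplex W) (φ : V → W) : Prop where
  injective : Function.Injective φ
  simplicial : imageComplex φ K ≤ L

/-- The moment-angle-complex `𝒵_K = ⋃_{σ ∈ K} (D², S¹)^σ ⊆ (D²)^V ⊆ ℂ^V`. The union includes the
empty simplex. -/
def MomentAngleComplex (K : PreAbstractSimplicialComplex V) : Set (V → ℂ) :=
  {z | ∃ σ : Finset V, (σ.Nonempty → σ ∈ K) ∧ (∀ i ∈ σ, ‖z i‖ ≤ 1) ∧ ∀ i ∉ σ, ‖z i‖ = 1}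

/-- Extension by `1` along an injective map of index sets is continuous. -/
theorem continuous_extend_one {M : Type} [TopologicalSpace M] [One M] {φ : V → W}
    (hφ : Function.Injective φ) : Continuous fun z : V → M => Function.extend φ z 1 := by
  refine continuous_pi fun j => ?_
  by_cases hj : ∃ i, φ i = j
  · obtain ⟨i, rfl⟩ := hj
    simpa only [hφ.extend_apply] using continuous_apply i
  · simpa only [Function.extend_apply' _ _ _ hj] using continuous_const

theorem extend_one_mem {K : PreAbstractSimplicialComplex V} {L : PreAbstractSimplicialComplex W}
    {φ : V → W} (hφ : IsSimplicialEmbedding K L φ) {z : V → ℂ} (hz : z ∈ MomentAngleComplex K) :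
    Function.extend φ z 1 ∈ MomentAngleComplex L := by
  classical
  obtain ⟨σ, hσ, h1, h2⟩ := hz
  refine ⟨σ.image φ, fun hne => ?_, fun j hj => ?_, fun j hj => ?_⟩
  · refine hφ.simplicial ⟨σ, hσ (Finset.image_nonempty.mp hne), ?_⟩
    ext; simp
  · obtain ⟨i, hi, rfl⟩ := Finset.mem_image.mp hj
    rw [hφ.injective.extend_apply]
    exact h1 i hi
  · by_cases hj' : ∃ i, φ i = j
    · obtain ⟨i, rfl⟩ := hj'
      rw [hφ.injective.extend_apply]
      exact h2 i fun hi => hj (Finset.mem_image_of_mem φ hi)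
    · rw [Function.extend_apply' _ _ _ hj']
      simp

/-- The map `𝒵_K → 𝒵_L` induced by an injective simplicial map: it puts the coordinate of the vertex
`i` in the place `φ i`, and `1` in the places of the vertices outside the image of `φ`. -/
def MomentAngleComplex.map {K : PreAbstractSimplicialComplex V}
    {L : PreAbstractSimplicialComplex W} {φ : V → W} (hφ : IsSimplicialEmbedding K L φ) :
    C(MomentAngleComplex K, MomentAngleComplex L) where
  toFun z := ⟨Function.extend φ (z : V → ℂ) 1, extend_one_mem hφ z.2⟩
  continuous_toFun :=
    ((continuous_extend_one hφ.injective).comp continuous_subtype_val).subtype_mk _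

end Complexes

/-! ### Nerve complexes and moment-angle manifolds -/

section MomentAngle

variable {E : Type} [NormedAddCommGroup E] [NormedSpace ℝ E]

/-- The nerve complex `K_C`: its vertices are the facets of `C`, and a set of facets is a simplex if
these facets have a common point. -/
def nerveComplex (C : Set E) : PreAbstractSimplicialComplex (Facet C) where
  faces := {σ | σ.Nonempty ∧ (⋂ G ∈ σ, (G : Set E)).Nonempty}
  isRelLowerSet_faces := by
    rintro σ ⟨hne, x, hx⟩
    refine ⟨hne, fun τ hτ hne' => ⟨hne', x, ?_⟩⟩
    simp only [Set.mem_iInter] at hx ⊢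
    exact fun G hG => hx G (hτ hG)

/-- The relation on `T^{𝓕(C)} × C`: `(t, p) ∼ (s, q)` if `p = q` and `t s⁻¹` lies in the coordinate
subtorus of the facets that contain the minimal face of `p`, i.e. of the facets through `p`. -/
def momentAngleSetoid (C : Set E) : Setoid ((Facet C → Circle) × C) where
  r x y := x.2 = y.2 ∧ ∀ G : Facet C, (x.2 : E) ∉ (G : Set E) → (x.1 * y.1⁻¹) G = 1
  iseqv :=
    { refl := fun x => ⟨rfl, fun G _ => by simp⟩
      symm := by
        rintro ⟨t, p⟩ ⟨s, q⟩ ⟨h, h'⟩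
        obtain rfl : p = q := h
        refine ⟨rfl, fun G hG => ?_⟩
        have := h' G hG
        simp only [Pi.mul_apply, Pi.inv_apply, mul_inv_eq_one] at this ⊢
        exact this.symm
      trans := by
        rintro ⟨t, p⟩ ⟨s, q⟩ ⟨u, w⟩ ⟨h, h'⟩ ⟨k, k'⟩
        obtain rfl : p = q := h
        obtain rfl : p = w := k
        refine ⟨rfl, fun G hG => ?_⟩
        have h1 := h' G hG
        have h2 := k' G hG
        simp only [Pi.mul_apply, Pi.inv_apply, mul_inv_eq_one] at h1 h2 ⊢
        exact h1.trans h2 }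

/-- The moment-angle manifold `𝒵_C = (T^{𝓕(C)} × C) / ∼`, with the quotient topology. -/
def MomentAngleManifold (C : Set E) : Type :=
  Quotient (momentAngleSetoid C)

instance (C : Set E) : TopologicalSpace (MomentAngleManifold C) :=
  inferInstanceAs (TopologicalSpace (Quotient (momentAngleSetoid C)))

/-- `φ : 𝓕(F) → 𝓕(P)` sends every facet `G` of `F` to a facet of `P` which cuts `G` out of `F`. -/
def IsFacetMap (P F : Set E) (φ : Facet F → Facet P) : Prop :=
  ∀ G : Facet F, (G : Set E) = F ∩ (φ G : Set E)

theorem IsFacetMap.injective {P F : Set E} {φ : Facet F → Facet P} (hφ : IsFacetMap P F φ) :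
    Function.Injective φ := fun G G' h =>
  Subtype.ext ((hφ G).trans (by rw [h]; exact (hφ G').symm))

/-- The facet map defines a nondegenerate injective simplicial map `Φ : K_F → K_P`. -/
theorem IsFacetMap.isSimplicialEmbedding {P F : Set E} {φ : Facet F → Facet P}
    (hφ : IsFacetMap P F φ) : IsSimplicialEmbedding (nerveComplex F) (nerveComplex P) φ := by
  classical
  refine ⟨hφ.injective, ?_⟩
  rintro _ ⟨σ, ⟨hne, x, hx⟩, rfl⟩
  refine ⟨by simpa using hne, x, ?_⟩
  simp only [Set.mem_iInter, Finset.mem_image, forall_exists_index, and_imp] at hx ⊢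
  rintro _ G hG rfl
  have := hx G hG
  rw [hφ G] at this
  exact this.2

/-- The map `𝒵_F → 𝒵_P` induced by the inclusion `F ⊆ P` of a face,
`[t, p] ↦ [φ̃ t, p]` where `φ̃ t` is `t` in the places `φ G` and `1` in the other places. -/
def faceEmbedding {P F : Set E} (hFP : F ⊆ P) {φ : Facet F → Facet P}
    (hφ : IsFacetMap P F φ) : C(MomentAngleManifold F, MomentAngleManifold P) where
  toFun := Quotient.map'
    (s₁ := momentAngleSetoid F) (s₂ := momentAngleSetoid P)
    (fun x => (Function.extend φ x.1 1, Set.inclusion hFP x.2)) (by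
      rintro ⟨t, p⟩ ⟨s, q⟩ ⟨h, h'⟩
      obtain rfl : p = q := h
      refine ⟨rfl, fun j hj => ?_⟩
      by_cases hj' : ∃ G, φ G = j
      · obtain ⟨G, rfl⟩ := hj'
        have hG : (p : E) ∉ (G : Set E) := fun hp => hj (by rw [hφ G] at hp; exact hp.2)
        have := h' G hG
        simpa [hφ.injective.extend_apply] using this
      · simp [Function.extend_apply' _ _ _ hj'])
  continuous_toFun := by
    refine Continuous.quotient_map' ?_ _
    exact ((continuous_extend_one hφ.injective).comp continuous_fst).prodMk
      ((continuous_inclusion hFP).comp continuous_snd)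

end MomentAngle

/-! ### The singular cohomology ring -/

section Cohomology

open CategoryTheory Opposite
open scoped Simplicial

universe u

variable (R : Type u) [CommRing R]

/-- Cochains on a simplicial set with coefficients in `R`. -/
abbrev Cochain (S : SSet.{0}) (p : ℕ) : Type u :=
  S _⦋p⦌ → R

variable {R} {S T : SSet.{0}}

/-- The coboundary `(δ f)(x) = ∑ i, (-1)ⁱ f(dᵢ x)`. -/
def coboundary (p : ℕ) : Cochain R S p →ₗ[R] Cochain R S (p + 1) where
  toFun f x := ∑ i : Fin (p + 2), (-1) ^ (i : ℕ) * f (S.δ i x)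
  map_add' f g := by ext x; simp [mul_add, Finset.sum_add_distrib]
  map_smul' c f := by
    ext x
    simp only [Pi.smul_apply, smul_eq_mul, RingHom.id_apply, Finset.mul_sum]
    exact Finset.sum_congr rfl fun i _ => by ring

variable (R S) in
/-- Cocycles of degree `p`. -/
def cocycles (p : ℕ) : Submodule R (Cochain R S p) :=
  LinearMap.ker (coboundary p)

variable (R S) in
/-- Coboundaries of degree `p`. -/
def coboundaries (p : ℕ) : Submodule R (Cochain R S p) :=
  match p with
  | 0 => ⊥
  | p + 1 => LinearMap.range (coboundary p)

variable (R S) in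
/-- The cohomology `Hᵖ(S; R)`: cocycles modulo coboundaries. -/
abbrev SimplicialCohomology (p : ℕ) : Type u :=
  cocycles R S p ⧸ (coboundaries R S p).submoduleOf (cocycles R S p)

/-- The front face on the first `p + 1` vertices of an `n`-simplex, `n = p + q`. -/
def frontFace {p q n : ℕ} (h : p + q = n) (x : S _⦋n⦌) : S _⦋p⦌ :=
  S.map (SimplexCategory.subinterval (n := n) 0 p (by lia)).op x

/-- The back face on the last `q + 1` vertices of an `n`-simplex, `n = p + q`. -/
def backFace {p q n : ℕ} (h : p + q = n) (x : S _⦋n⦌) : S _⦋q⦌ :=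
  S.map (SimplexCategory.subinterval (n := n) p q (by lia)).op x

/-- The Alexander–Whitney cup product of cochains. -/
def cochainCup {p q n : ℕ} (h : p + q = n) :
    Cochain R S p →ₗ[R] Cochain R S q →ₗ[R] Cochain R S n :=
  LinearMap.mk₂ R (fun f g x => f (frontFace h x) * g (backFace h x))
    (fun _ _ _ => by ext x; simp [add_mul]) (fun _ _ _ => by ext x; simp [mul_assoc])
    (fun _ _ _ => by ext x; simp [mul_add])
    (fun _ _ _ => by ext x; simp only [Pi.smul_apply, smul_eq_mul]; ring)

theorem map_comp_apply {a b c : ℕ} (α : ⦋a⦌ ⟶ ⦋b⦌) (β : ⦋b⦌ ⟶ ⦋c⦌) (x : S _⦋c⦌) :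
    S.map α.op (S.map β.op x) = S.map (α ≫ β).op x := by
  simp

theorem subinterval_val {a j l : ℕ} (h : j + l ≤ a) (i : Fin (l + 1)) :
    ((SimplexCategory.Hom.toOrderHom (SimplexCategory.subinterval (n := a) j l h) i : Fin (a + 1)) : ℕ) =
      (i : ℕ) + j := rfl

theorem δ_val {a : ℕ} (i : Fin (a + 2)) (j : Fin (a + 1)) :
    ((SimplexCategory.Hom.toOrderHom (SimplexCategory.δ i) j : Fin (a + 2)) : ℕ) =
      if (j : ℕ) < i then (j : ℕ) else j + 1 := by
  change ((i.succAbove j : Fin (a + 2)) : ℕ) = _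
  simp only [Fin.succAbove, Fin.lt_def, Fin.val_castSucc]
  split_ifs <;> simp

theorem frontFace_δ_of_le {p q n : ℕ} (h : p + q = n) (i : Fin (n + 2)) (hi : (i : ℕ) ≤ p)
    (x : S _⦋n + 1⦌) : frontFace h (S.δ i x) =
      S.δ ⟨i, by lia⟩ (frontFace (show p + 1 + q = n + 1 by lia) x) := by
  simp only [frontFace, SimplicialObject.δ, map_comp_apply]
  congr 3
  apply Quiver.Hom.unop_inj
  ext j
  have := j.isLt
  simp at this ⊢
  repeat rw [δ_val]
  repeat rw [subinterval_val]
  repeat rw [δ_val]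
  try split_ifs <;> lia

theorem backFace_δ_of_le {p q n : ℕ} (h : p + q = n) (i : Fin (n + 2)) (hi : (i : ℕ) ≤ p)
    (x : S _⦋n + 1⦌) : backFace h (S.δ i x) =
      backFace (show p + 1 + q = n + 1 by lia) x := by
  simp only [backFace, SimplicialObject.δ, map_comp_apply]
  congr 3
  apply Quiver.Hom.unop_inj
  ext j
  have := j.isLt
  simp at this ⊢
  repeat rw [δ_val]
  repeat rw [subinterval_val]
  repeat rw [δ_val]
  try simp only [Fin.val_last, Fin.val_zero]
  try split_ifs <;> lia

theorem frontFace_δ_of_lt {p q n : ℕ} (h : p + q = n) (i : Fin (n + 2)) (hi : p < (i : ℕ))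
    (x : S _⦋n + 1⦌) : frontFace h (S.δ i x) =
      frontFace (show p + (q + 1) = n + 1 by lia) x := by
  simp only [frontFace, SimplicialObject.δ, map_comp_apply]
  congr 3
  apply Quiver.Hom.unop_inj
  ext j
  have := j.isLt
  simp at this ⊢
  repeat rw [δ_val]
  repeat rw [subinterval_val]
  repeat rw [δ_val]
  try simp only [Fin.val_last, Fin.val_zero]
  try split_ifs <;> lia

theorem backFace_δ_of_lt {p q n : ℕ} (h : p + q = n) (i : Fin (n + 2)) (j : Fin (q + 2))
    (hi : (i : ℕ) = p + j) (x : S _⦋n + 1⦌) : backFace h (S.δ i x) =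
      S.δ j (backFace (show p + (q + 1) = n + 1 by lia) x) := by
  simp only [backFace, SimplicialObject.δ, map_comp_apply]
  congr 3
  apply Quiver.Hom.unop_inj
  ext k
  have := k.isLt
  simp at this ⊢
  repeat rw [δ_val]
  repeat rw [subinterval_val]
  repeat rw [δ_val]
  try simp only [Fin.val_last, Fin.val_zero]
  try split_ifs <;> lia

theorem δ_last_frontFace {p q n : ℕ} (h : p + q = n) (x : S _⦋n + 1⦌) :
    S.δ (Fin.last (p + 1)) (frontFace (show p + 1 + q = n + 1 by lia) x) =
      frontFace (show p + (q + 1) = n + 1 by lia) x := by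
  simp only [frontFace, SimplicialObject.δ, map_comp_apply]
  congr 3
  apply Quiver.Hom.unop_inj
  ext k
  have := k.isLt
  simp at this ⊢
  repeat rw [δ_val]
  repeat rw [subinterval_val]
  repeat rw [δ_val]
  try simp only [Fin.val_last, Fin.val_zero]
  try split_ifs <;> lia

theorem δ_zero_backFace {p q n : ℕ} (h : p + q = n) (x : S _⦋n + 1⦌) :
    S.δ 0 (backFace (show p + (q + 1) = n + 1 by lia) x) =
      backFace (show p + 1 + q = n + 1 by lia) x := by
  simp only [backFace, SimplicialObject.δ, map_comp_apply]
  congr 3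
  apply Quiver.Hom.unop_inj
  ext k
  have := k.isLt
  simp at this ⊢
  repeat rw [δ_val]
  repeat rw [subinterval_val]
  repeat rw [δ_val]
  try simp only [Fin.val_last, Fin.val_zero]
  try split_ifs <;> lia

/-- The Leibniz rule. -/
theorem coboundary_cochainCup {p q n : ℕ} (h : p + q = n) (f : Cochain R S p)
    (g : Cochain R S q) :
    coboundary n (cochainCup h f g) =
      cochainCup (show p + 1 + q = n + 1 by lia) (coboundary p f) g +
        (-1 : R) ^ p • cochainCup (show p + (q + 1) = n + 1 by lia) f (coboundary q g) := by
  ext x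
  simp only [coboundary, cochainCup, LinearMap.coe_mk, AddHom.coe_mk, LinearMap.mk₂_apply,
    Pi.add_apply, Pi.smul_apply, smul_eq_mul]
  rw [← Fin.sum_congr' _ (show (p + 1) + (q + 1) = n + 2 by lia), Fin.sum_univ_add,
    Fin.sum_univ_castSucc (n := p + 1), Fin.sum_univ_succ (n := q + 1), δ_last_frontFace h,
    δ_zero_backFace h]
  have h1 : ∀ i : Fin (p + 1), (-1 : R) ^ (i : ℕ) *
      (f (frontFace h (S.δ (Fin.cast (show (p + 1) + (q + 1) = n + 2 by lia)
          (Fin.castAdd (q + 1) i)) x)) *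
        g (backFace h (S.δ (Fin.cast (show (p + 1) + (q + 1) = n + 2 by lia)
          (Fin.castAdd (q + 1) i)) x))) =
      (-1) ^ (i : ℕ) * f (S.δ i.castSucc (frontFace (show p + 1 + q = n + 1 by lia) x)) *
        g (backFace (show p + 1 + q = n + 1 by lia) x) := by
    intro i
    rw [frontFace_δ_of_le h _ (by simp; lia), backFace_δ_of_le h _ (by simp; lia), mul_assoc]
    rfl
  have h2 : ∀ j : Fin (q + 1), (-1 : R) ^ (p + 1 + (j : ℕ)) *
      (f (frontFace h (S.δ (Fin.cast (show (p + 1) + (q + 1) = n + 2 by lia)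
          (Fin.natAdd (p + 1) j)) x)) *
        g (backFace h (S.δ (Fin.cast (show (p + 1) + (q + 1) = n + 2 by lia)
          (Fin.natAdd (p + 1) j)) x))) =
      (-1) ^ p * (f (frontFace (show p + (q + 1) = n + 1 by lia) x) *
        ((-1) ^ ((j : ℕ) + 1) * g (S.δ j.succ (backFace (show p + (q + 1) = n + 1 by lia) x)))) := by
    intro j
    rw [frontFace_δ_of_lt h _ (by simp; lia), backFace_δ_of_lt h _ j.succ (by simp; lia)]
    ring
  simp only [Fin.val_cast, Fin.val_castAdd, Fin.val_natAdd, Fin.val_castSucc, Fin.val_last,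
    Fin.val_succ, Fin.val_zero, h1, h2, add_mul, mul_add, Finset.sum_mul, Finset.mul_sum]
  ring

theorem coboundary_mem_coboundaries {p : ℕ} (f : Cochain R S p) :
    coboundary p f ∈ coboundaries R S (p + 1) := ⟨f, rfl⟩

theorem cochainCup_mem_cocycles {p q n : ℕ} (h : p + q = n) {f : Cochain R S p}
    {g : Cochain R S q} (hf : f ∈ cocycles R S p) (hg : g ∈ cocycles R S q) :
    cochainCup h f g ∈ cocycles R S n := by
  rw [cocycles, LinearMap.mem_ker] at *
  rw [coboundary_cochainCup, hf, hg]
  simp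

theorem cochainCup_mem_coboundaries_left {p q n : ℕ} (h : p + q = n) {f : Cochain R S p}
    {g : Cochain R S q} (hf : f ∈ coboundaries R S p) (hg : g ∈ cocycles R S q) :
    cochainCup h f g ∈ coboundaries R S n := by
  cases p with
  | zero =>
    obtain rfl : f = 0 := hf
    rw [map_zero]
    exact zero_mem _
  | succ p =>
    obtain ⟨e, rfl⟩ := hf
    obtain ⟨k, rfl⟩ : ∃ k, n = k + 1 := ⟨p + q, by lia⟩
    have key := coboundary_cochainCup (show p + q = k by lia) e g
    rw [cocycles, LinearMap.mem_ker] at hg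
    rw [hg, map_zero, smul_zero, add_zero] at key
    rw [← key]
    exact coboundary_mem_coboundaries _

theorem cochainCup_mem_coboundaries_right {p q n : ℕ} (h : p + q = n) {f : Cochain R S p}
    {g : Cochain R S q} (hf : f ∈ cocycles R S p) (hg : g ∈ coboundaries R S q) :
    cochainCup h f g ∈ coboundaries R S n := by
  cases q with
  | zero =>
    obtain rfl : g = 0 := hg
    rw [map_zero]
    exact zero_mem _
  | succ q =>
    obtain ⟨e, rfl⟩ := hg
    obtain ⟨k, rfl⟩ : ∃ k, n = k + 1 := ⟨p + q, by lia⟩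
    have key := coboundary_cochainCup (show p + q = k by lia) f e
    rw [cocycles, LinearMap.mem_ker] at hf
    rw [hf, map_zero, LinearMap.zero_apply, zero_add] at key
    have key' : cochainCup h f (coboundary q e) =
        (-1 : R) ^ p • coboundary k (cochainCup (show p + q = k by lia) f e) := by
      rw [key, smul_smul, ← mul_pow]
      simp
    rw [key']
    exact Submodule.smul_mem _ _ (coboundary_mem_coboundaries _)

/-- The class of the cup product of two cocycles. -/
def cocycleCup {p q n : ℕ} (h : p + q = n) :
    cocycles R S p →ₗ[R] cocycles R S q →ₗ[R] SimplicialCohomology R S n :=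
  LinearMap.mk₂ R
    (fun f g => Submodule.Quotient.mk ⟨cochainCup h f g, cochainCup_mem_cocycles h f.2 g.2⟩)
    (fun f f' g => by
      rw [← Submodule.Quotient.mk_add]; congr 1; ext1; simp)
    (fun c f g => by
      rw [← Submodule.Quotient.mk_smul]; congr 1; ext1; simp)
    (fun f g g' => by
      rw [← Submodule.Quotient.mk_add]; congr 1; ext1; simp)
    (fun c f g => by
      rw [← Submodule.Quotient.mk_smul]; congr 1; ext1; simp)

variable (R S) in
/-- The cup product `Hᵖ(S; R) × H^q(S; R) → Hⁿ(S; R)`, `n = p + q`. -/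
def cup {p q n : ℕ} (h : p + q = n) :
    SimplicialCohomology R S p →ₗ[R] SimplicialCohomology R S q →ₗ[R]
      SimplicialCohomology R S n :=
  (Submodule.liftQ _
    (Submodule.liftQ _ (cocycleCup h) (fun f hf => by
      ext g
      exact (Submodule.Quotient.mk_eq_zero _).mpr
        (cochainCup_mem_coboundaries_left h hf g.2))).flip
    (fun g hg => by
      ext f
      exact (Submodule.Quotient.mk_eq_zero _).mpr
        (cochainCup_mem_coboundaries_right h f.2 hg))).flip

theorem cup_mk {p q n : ℕ} (h : p + q = n) (f : cocycles R S p) (g : cocycles R S q) :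
    cup R S h (Submodule.Quotient.mk f) (Submodule.Quotient.mk g) =
      Submodule.Quotient.mk ⟨cochainCup h f g, cochainCup_mem_cocycles h f.2 g.2⟩ := rfl

variable (R S) in
/-- The unit of the cohomology ring, the class of the constant cochain `1`. -/
def cohomologyOne : SimplicialCohomology R S 0 :=
  Submodule.Quotient.mk ⟨fun _ => 1, by
    rw [cocycles, LinearMap.mem_ker]
    ext x
    simp [coboundary, Fin.sum_univ_two]⟩

/-- The map of cochains induced by a map of simplicial sets. -/
def cochainPullback (θ : S ⟶ T) (p : ℕ) : Cochain R T p →ₗ[R] Cochain R S p :=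
  LinearMap.funLeft R R (θ.app (op ⦋p⦌))

theorem coboundary_cochainPullback (θ : S ⟶ T) (p : ℕ) (f : Cochain R T p) :
    coboundary p (cochainPullback θ p f) = cochainPullback θ (p + 1) (coboundary p f) := by
  ext x
  simp [coboundary, cochainPullback, LinearMap.funLeft_apply, SSet.δ_naturality_apply]

theorem cochainPullback_mem_cocycles (θ : S ⟶ T) (p : ℕ) :
    cocycles R T p ≤ (cocycles R S p).comap (cochainPullback θ p) := by
  intro f hf
  rw [Submodule.mem_comap, cocycles, LinearMap.mem_ker, coboundary_cochainPullback]
  rw [cocycles, LinearMap.mem_ker] at hf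
  rw [hf, map_zero]

theorem cochainPullback_mem_coboundaries (θ : S ⟶ T) (p : ℕ) :
    coboundaries R T p ≤ (coboundaries R S p).comap (cochainPullback θ p) := by
  cases p with
  | zero => exact bot_le
  | succ p =>
    rintro _ ⟨e, rfl⟩
    exact ⟨cochainPullback θ p e, coboundary_cochainPullback θ p e⟩

/-- The map induced in cohomology by a map of simplicial sets. -/
def cohomologyPullback (θ : S ⟶ T) (p : ℕ) :
    SimplicialCohomology R T p →ₗ[R] SimplicialCohomology R S p :=
  Submodule.mapQ _ _ ((cochainPullback θ p).restrict (cochainPullback_mem_cocycles θ p))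
    (fun _ hf => cochainPullback_mem_coboundaries θ p hf)

variable (R) in
/-- A homomorphism of cohomology rings `H^*(S; R) → H^*(T; R)`: an `R`-linear map in every degree
which respects the unit and the cup products. -/
structure CohomologyRingHom (S T : SSet.{0}) where
  toLinearMap : ∀ p, SimplicialCohomology R S p →ₗ[R] SimplicialCohomology R T p
  map_one : toLinearMap 0 (cohomologyOne R S) = cohomologyOne R T
  map_cup : ∀ {p q n : ℕ} (h : p + q = n) (x : SimplicialCohomology R S p)
    (y : SimplicialCohomology R S q),
    toLinearMap n (cup R S h x y) = cup R T h (toLinearMap p x) (toLinearMap q y)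

/-- A ring homomorphism `θ` in cohomology is a split ring epimorphism if it has a right inverse
which is a ring homomorphism too. -/
def CohomologyRingHom.IsSplitEpi (θ : CohomologyRingHom R S T) : Prop :=
  ∃ s : CohomologyRingHom R T S, ∀ p x, θ.toLinearMap p (s.toLinearMap p x) = x

variable (R) in
/-- The ring homomorphism induced in cohomology by a map of simplicial sets. -/
def CohomologyRingHom.pullback (θ : S ⟶ T) : CohomologyRingHom R T S where
  toLinearMap := cohomologyPullback θ
  map_one := rfl
  map_cup {p q n} h x y := by
    induction x using Submodule.Quotient.induction_on with | _ f
    induction y using Submodule.Quotient.induction_on with | _ g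
    refine congrArg Submodule.Quotient.mk (Subtype.ext (funext fun x => ?_))
    simp [cochainCup, cochainPullback, LinearMap.funLeft_apply, frontFace, backFace]

/-- The singular simplicial set of a topological space. -/
def singularSet (X : Type) [TopologicalSpace X] : SSet.{0} :=
  TopCat.toSSet.obj (TopCat.of X)

variable (R) in
/-- The ring homomorphism `f^* : H^*(Y; R) → H^*(X; R)` of singular cohomology rings induced by a
continuous map `f : X → Y`. -/
def singularCohomologyMap {X Y : Type} [TopologicalSpace X] [TopologicalSpace Y] (f : C(X, Y)) :
    CohomologyRingHom R (singularSet Y) (singularSet X) :=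
  CohomologyRingHom.pullback R (TopCat.toSSet.map (TopCat.ofHom f))

end Cohomology

end

/-! Let `σ` be the set of facets of `P` through `F`. Simplicity means that the functions `ℓ j = f j
+ c j` defining the facets through a point have independent linear parts. Hence a set of facets with
a common point has a common point on no other facet, its intersection has codimension equal to its
size, and the facets of `F` are the sets `F ∩ j` for the vertices `j` of the link of `σ` in `K_P`
(`exists_facetMap`). If a simplex `τ` consists of such vertices, then `τ ∪ σ` is pairwise joined, so
flagness makes it a simplex (`union_mem_of_flag`). Thus `K_F` is the link of `σ`, and this link is a
full subcomplex (`imageComplex_eq`).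

To identify `𝒵_P` with `𝒵_{K_P}`, pick for every simplex `τ`, the empty one included, a point `b τ`
at which exactly the functions of `τ` vanish. A point `u` of the cube with support in a simplex is
sent to the average of `b {u ≥ t}` over `t ∈ [0, 1]`. This is a homeomorphism onto `P` under which
`ℓ j` vanishes exactly where `u j = 1` (`IsBarycentricSystem.bijOn`), so `[t, p] ↦ (t j * (1 - u
j))` identifies the two spaces.

Used directly, this homeomorphism sends `F` to points with coordinates `0` on `σ`, whereas `Φ̂` has
coordinates `1` there. The face is therefore first moved off the boundary. In the model `|z j| = ℓ
j(p)`, a neighbourhood of the part over `F` is a union of copies of a polydisc `D^σ`, over slices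
parallel to `F` with the combinatorics of `F`. A homeomorphism of the polydisc fixing its boundary
and moving `0` to `(ε/2, …, ε/2)` extends to the whole model (`IsSliceSystem.exists_homeomorph`). If
`b τ` is chosen on the slice at `ε/2` for every `τ` in the link, the moved face has `u = 0` on `σ`
and outside the link, so its coordinates there are `1` (`exists_homeomorph_straightening`).

The image of the face embedding is then exactly the image of `Φ̂`, which gives `H₁`. Since the
subcomplex is full, forgetting coordinates retracts `𝒵_{K_P}` onto `𝒵_{K_F}`; transported by `H₁`
and `H₂` this is `ρ`, and `ρ^*` splits the map in cohomology. -/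

noncomputable section

/-! ### Layer integrals -/

section LayerIntegral

open MeasureTheory Set Filter Topology

variable {V E : Type} [Fintype V] [NormedAddCommGroup E]

/-- The superlevel set `{i | t ≤ u i}`. -/
def superlevel (u : V → ℝ) (t : ℝ) : Finset V :=
  Finset.univ.filter fun i => t ≤ u i

@[simp] theorem mem_superlevel {u : V → ℝ} {t : ℝ} {i : V} : i ∈ superlevel u t ↔ t ≤ u i := by
  simp [superlevel]

theorem stronglyMeasurable_superlevel (b : Finset V → E) (u : V → ℝ) :
    StronglyMeasurable fun t => b (superlevel u t) := by
  let _ : MeasurableSpace (Finset V) := ⊤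
  have : DiscreteMeasurableSpace (Finset V) := ⟨fun _ => trivial⟩
  refine (StronglyMeasurable.of_discrete (f := b)).comp_measurable ?_
  refine measurable_to_countable' fun σ => ?_
  have : superlevel u ⁻¹' {σ} = ⋂ i, {t | t ≤ u i ↔ i ∈ σ} := by
    ext t
    simp [Finset.ext_iff]
  rw [this]
  refine MeasurableSet.iInter fun i => ?_
  by_cases hi : i ∈ σ
  · simp only [hi, iff_true]
    exact measurableSet_Iic
  · simp only [hi, iff_false, not_le]
    exact measurableSet_Ioi

theorem norm_superlevel_le (b : Finset V → E) (u : V → ℝ) (t : ℝ) :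
    ‖b (superlevel u t)‖ ≤ ∑ σ : Finset V, ‖b σ‖ :=
  Finset.single_le_sum (f := fun σ => ‖b σ‖) (fun _ _ => norm_nonneg _) (Finset.mem_univ _)

theorem intervalIntegrable_superlevel (b : Finset V → E) (u : V → ℝ) (r s : ℝ) :
    IntervalIntegrable (fun t => b (superlevel u t)) volume r s := by
  refine (intervalIntegrable_const (c := ∑ σ : Finset V, ‖b σ‖)).mono_fun
    (stronglyMeasurable_superlevel b u).aestronglyMeasurable (Eventually.of_forall fun t => ?_)
  exact (norm_superlevel_le b u t).trans (le_abs_self _)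

variable [NormedSpace ℝ E]

/-- The average over `t ∈ [0, 1]` of the points `b σ`, where `σ` is the superlevel set `{u ≥ t}`.
It is affine on the simplices of the barycentric subdivision of the cube. -/
def layerIntegral (b : Finset V → E) (u : V → ℝ) : E :=
  ∫ t in (0 : ℝ)..1, b (superlevel u t)

/-- The layer integral depends continuously on the points `b σ` and on `u`. -/
theorem continuous_layerIntegral {X : Type} [TopologicalSpace X] [FirstCountableTopology X]
    {b : X → Finset V → E} {u : X → V → ℝ} (hb : Continuous b) (hu : Continuous u) :
    Continuous fun x => layerIntegral (b x) (u x) := by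
  refine continuous_iff_continuousAt.mpr fun x₀ => ?_
  refine intervalIntegral.continuousAt_of_dominated_interval
    (bound := fun _ => ∑ σ : Finset V, ‖b x₀ σ‖ + 1)
    (Eventually.of_forall fun x => (stronglyMeasurable_superlevel _ _).aestronglyMeasurable) ?_
    intervalIntegrable_const ?_
  · have h : Continuous fun x => ∑ σ : Finset V, ‖b x σ‖ :=
      continuous_finsetSum _ fun σ _ => ((continuous_apply σ).comp hb).norm
    filter_upwards [h.continuousAt.eventually (gt_mem_nhds (lt_add_one _))] with x hx
    exact Eventually.of_forall fun t _ => (norm_superlevel_le _ _ t).trans hx.le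
  -- For `t` outside the finite, hence null, set of values of `u x₀`, the superlevel set does not
  -- change near `x₀`.
  · have hfin : (range (u x₀)).Finite := finite_range _
    filter_upwards [compl_mem_ae_iff.mpr (hfin.measure_zero volume)] with t ht _
    have h : ∀ᶠ x in 𝓝 x₀, superlevel (u x) t = superlevel (u x₀) t := by
      have h1 : ∀ i, ∀ᶠ x in 𝓝 x₀, (t ≤ u x i ↔ t ≤ u x₀ i) := by
        intro i
        have hc : ContinuousAt (fun x => u x i) x₀ :=
          ((continuous_apply i).comp hu).continuousAt
        rcases lt_or_gt_of_ne (fun h => ht ⟨i, h⟩ : u x₀ i ≠ t) with h | h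
        · filter_upwards [hc.eventually (gt_mem_nhds h)] with x hx
          exact iff_of_false hx.not_ge h.not_ge
        · filter_upwards [hc.eventually (lt_mem_nhds h)] with x hx
          exact iff_of_true hx.le h.le
      filter_upwards [eventually_all.mpr h1] with x hx
      ext i
      simpa using hx i
    have h2 : ContinuousAt (fun x => b x (superlevel (u x₀) t)) x₀ :=
      ((continuous_apply _).comp hb).continuousAt
    refine h2.congr ?_
    filter_upwards [h] with x hx
    simp only [hx]

theorem layerIntegral_congr {b b' : Finset V → E} {u : V → ℝ}
    (h : ∀ t, 0 < t → t ≤ 1 → b (superlevel u t) = b' (superlevel u t)) :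
    layerIntegral b u = layerIntegral b' u := by
  refine intervalIntegral.integral_congr_ae (Eventually.of_forall fun t ht => ?_)
  rw [uIoc_of_le zero_le_one] at ht
  exact h t ht.1 ht.2

theorem map_layerIntegral [CompleteSpace E] (f : E →L[ℝ] ℝ) (c : ℝ) (b : Finset V → E)
    (u : V → ℝ) : f (layerIntegral b u) + c = layerIntegral (fun σ => f (b σ) + c) u := by
  simp only [layerIntegral]
  rw [intervalIntegral.integral_add ?_ intervalIntegrable_const,
    f.intervalIntegral_comp_comm (intervalIntegrable_superlevel b u 0 1)]
  · simp
  · exact intervalIntegrable_superlevel (fun σ => f (b σ)) u 0 1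

open Classical in
/-- Scaling the coordinates outside `σ` by `s` moves the layer integral towards `b σ`. -/
theorem layerIntegral_scale [CompleteSpace E] (b : Finset V → E) {σ : Finset V} {s : ℝ}
    (hs : s ∈ Icc (0 : ℝ) 1) {v : V → ℝ} (hv : ∀ i ∈ σ, v i = 1) (hv1 : ∀ i, v i ≤ 1) :
    layerIntegral b (fun i => if i ∈ σ then 1 else s * v i) =
      (1 - s) • b σ + s • layerIntegral b v := by
  set u : V → ℝ := fun i => if i ∈ σ then 1 else s * v i with hu
  -- Cut at `t = s`: above `s` the superlevel set is `σ`, below `s` it is the superlevel set of `v`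
  -- at `t / s`.
  rw [layerIntegral, ← intervalIntegral.integral_add_adjacent_intervals
    (intervalIntegrable_superlevel b u 0 s) (intervalIntegrable_superlevel b u s 1), add_comm]
  congr 1
  · have h : ∀ t ∈ Ioc s 1, superlevel u t = σ := by
      intro t ht
      ext i
      simp only [mem_superlevel, hu]
      split_ifs with hi
      · simp [hi, ht.2]
      · simp only [hi, iff_false, not_le]
        nlinarith [ht.1, hv1 i, hs.1]
    rw [intervalIntegral.integral_congr_ae (g := fun _ => b σ)]
    · simp
    · refine Eventually.of_forall fun t ht => ?_
      rw [uIoc_of_le hs.2] at ht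
      rw [h t ht]
  · rcases hs.1.eq_or_lt with rfl | h0
    · simp
    have h : ∀ t ∈ Ioc 0 s, superlevel u t = superlevel v (t / s) := by
      intro t ht
      ext i
      simp only [mem_superlevel, hu]
      split_ifs with hi
      · simp only [hv i hi, div_le_one h0]
        exact iff_of_true (ht.2.trans hs.2) ht.2
      · rw [div_le_iff₀ h0, mul_comm]
    rw [intervalIntegral.integral_congr_ae (g := fun t => b (superlevel v (t / s)))]
    · rw [intervalIntegral.integral_comp_div (fun t => b (superlevel v t)) h0.ne']
      simp [layerIntegral, div_self h0.ne']
    · refine Eventually.of_forall fun t ht => ?_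
      rw [uIoc_of_le hs.1] at ht
      rw [h t ht]

open Classical in
theorem layerIntegral_indicator [CompleteSpace E] (b : Finset V → E) (σ : Finset V) :
    layerIntegral b (fun i => if i ∈ σ then 1 else 0) = b σ := by
  have := layerIntegral_scale b (σ := σ) (s := 0) (v := fun _ => 1) (by simp) (by simp) (by simp)
  simpa using this

theorem layerIntegral_eq_zero {b : Finset V → ℝ} {u : V → ℝ} {j : V} (hj : 1 ≤ u j)
    (h : ∀ t, 0 < t → t ≤ 1 → j ∈ superlevel u t → b (superlevel u t) = 0) :
    layerIntegral b u = 0 := by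
  rw [layerIntegral_congr (b' := fun _ => 0)]
  · simp [layerIntegral]
  · exact fun t h0 h1 => h t h0 h1 (mem_superlevel.mpr (h1.trans hj))

/-- The integrand is positive on `(u j, 1]`, an interval of positive length, because `j` is missing
from the superlevel sets there. -/
theorem layerIntegral_pos {b : Finset V → ℝ} {u : V → ℝ} {j : V} (hj0 : 0 ≤ u j) (hj : u j < 1)
    (h0 : ∀ t, 0 < t → t ≤ 1 → 0 ≤ b (superlevel u t))
    (h : ∀ t, 0 < t → t ≤ 1 → j ∉ superlevel u t → 0 < b (superlevel u t)) :
    0 < layerIntegral b u := by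
  rw [layerIntegral, ← intervalIntegral.integral_add_adjacent_intervals
    (intervalIntegrable_superlevel b u 0 (u j)) (intervalIntegrable_superlevel b u (u j) 1)]
  refine add_pos_of_nonneg_of_pos ?_ ?_
  · rw [intervalIntegral.integral_of_le hj0]
    refine setIntegral_nonneg measurableSet_Ioc fun t ht => ?_
    exact h0 t ht.1 (ht.2.trans hj.le)
  · refine intervalIntegral.intervalIntegral_pos_of_pos_on (intervalIntegrable_superlevel b u _ _)
      (fun t ht => ?_) hj
    exact h t (hj0.trans_lt ht.1) ht.2.le (by simpa using ht.1)

end LayerIntegral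

/-! ### Barycentric coordinates on polytopes with generic points on their faces -/

section Barycentric

open MeasureTheory Set Filter Topology

variable {V E : Type} [Fintype V]

/-- The points of the unit cube whose support belongs to `K`. -/
def layerDomain (K : Set (Finset V)) : Set (V → ℝ) :=
  {u | (∀ i, u i ∈ Icc (0 : ℝ) 1) ∧ ∃ σ ∈ K, ∀ i ∉ σ, u i = 0}

omit [Fintype V] in
theorem layerDomain_mono {K L : Set (Finset V)} (h : K ⊆ L) : layerDomain K ⊆ layerDomain L :=
  fun _ ⟨hu, σ, hσ, h0⟩ => ⟨hu, σ, h hσ, h0⟩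

theorem isCompact_layerDomain (K : Set (Finset V)) : IsCompact (layerDomain K) := by
  have h1 : IsCompact (Icc (0 : V → ℝ) 1) := isCompact_Icc
  refine h1.of_isClosed_subset ?_ fun u hu => ⟨fun i => (hu.1 i).1, fun i => (hu.1 i).2⟩
  have : layerDomain K = Icc (0 : V → ℝ) 1 ∩ ⋃ σ ∈ K, ⋂ i, {u | i ∉ σ → u i = 0} := by
    ext u
    simp [layerDomain, Pi.le_def, forall_and]
  rw [this]
  refine isClosed_Icc.inter ((toFinite K).isClosed_biUnion fun σ _ => isClosed_iInter fun i => ?_)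
  by_cases hi : i ∈ σ
  · simp [hi]
  · simpa [hi] using isClosed_eq (continuous_apply i) continuous_const

theorem superlevel_mem {K : Set (Finset V)} (hK : ∀ σ ∈ K, ∀ τ ⊆ σ, τ ∈ K) {u : V → ℝ}
    (hu : u ∈ layerDomain K) {t : ℝ} (ht : 0 < t) : superlevel u t ∈ K := by
  obtain ⟨-, σ, hσ, h0⟩ := hu
  refine hK σ hσ _ fun i hi => ?_
  by_contra h
  rw [mem_superlevel, h0 i h] at hi
  exact ht.not_ge hi

omit [Fintype V] in
open Classical in
theorem indicator_mem_layerDomain {K : Set (Finset V)} {σ : Finset V} (hσ : σ ∈ K) :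
    (fun i => if i ∈ σ then (1 : ℝ) else 0) ∈ layerDomain K := by
  refine ⟨fun i => ?_, σ, hσ, fun i hi => by simp [hi]⟩
  dsimp only
  split_ifs <;> simp

variable [NormedAddCommGroup E] [NormedSpace ℝ E]

/-- The set of indices of the affine functions `f j + c j` which vanish at `x`. -/
def zeroSet (f : V → E →L[ℝ] ℝ) (c : V → ℝ) (x : E) : Finset V :=
  Finset.univ.filter fun j => f j x + c j = 0

@[simp] theorem mem_zeroSet {f : V → E →L[ℝ] ℝ} {c : V → ℝ} {x : E} {j : V} :
    j ∈ zeroSet f c x ↔ f j x + c j = 0 := by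
  simp [zeroSet]

/-- `Q` is a compact set cut out of an affine subspace by the inequalities `0 ≤ f j + c j`, the
family `K` contains the sets of inequalities which are sharp at some point, and `b σ` is a point at
which exactly the inequalities of `σ` are sharp. -/
structure IsBarycentricSystem (Q : Set E) (f : V → E →L[ℝ] ℝ) (c : V → ℝ) (K : Set (Finset V))
    (b : Finset V → E) : Prop where
  isCompact : IsCompact Q
  nonneg : ∀ x ∈ Q, ∀ j, 0 ≤ f j x + c j
  -- Here `r` is any real number: besides convexity this allows a segment to be prolonged until a
  -- new inequality becomes sharp.
  line_mem : ∀ x ∈ Q, ∀ y ∈ Q, ∀ r : ℝ, (∀ j, 0 ≤ f j (x + r • (y - x)) + c j) →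
    x + r • (y - x) ∈ Q
  zeroSet_mem : ∀ x ∈ Q, zeroSet f c x ∈ K
  subset_mem : ∀ σ ∈ K, ∀ τ ⊆ σ, τ ∈ K
  mem : ∀ σ ∈ K, b σ ∈ Q
  eq_zero_iff : ∀ σ ∈ K, ∀ j, f j (b σ) + c j = 0 ↔ j ∈ σ

omit [Fintype V] in
theorem affine_line (f : V → E →L[ℝ] ℝ) (c : V → ℝ) (x y : E) (r : ℝ) (j : V) :
    f j (x + r • (y - x)) + c j = (1 - r) * (f j x + c j) + r * (f j y + c j) := by
  simp only [map_add, map_smul, map_sub, smul_eq_mul]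
  ring

namespace IsBarycentricSystem

variable {Q : Set E} {f : V → E →L[ℝ] ℝ} {c : V → ℝ} {K : Set (Finset V)} {b : Finset V → E}

theorem convex (h : IsBarycentricSystem Q f c K b) : Convex ℝ Q := by
  intro x hx y hy p q hp hq hpq
  have : p • x + q • y = x + q • (y - x) := by
    obtain rfl : p = 1 - q := by linarith
    module
  rw [this]
  refine h.line_mem x hx y hy q fun j => ?_
  rw [affine_line]
  have h1 := h.nonneg x hx j
  have h2 := h.nonneg y hy j
  have h3 : 0 ≤ 1 - q := by linarith
  positivity

variable [CompleteSpace E]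

theorem layerIntegral_mem (h : IsBarycentricSystem Q f c K b) {u : V → ℝ}
    (hu : u ∈ layerDomain K) : layerIntegral b u ∈ Q := by
  rw [layerIntegral, intervalIntegral.integral_of_le zero_le_one]
  have : IsProbabilityMeasure (volume.restrict (Ioc (0 : ℝ) 1)) := ⟨by simp⟩
  refine h.convex.integral_mem h.isCompact.isClosed ?_ ?_
  · filter_upwards [ae_restrict_mem measurableSet_Ioc] with t ht
    exact h.mem _ (superlevel_mem h.subset_mem hu ht.1)
  · exact (intervalIntegrable_iff_integrableOn_Ioc_of_le zero_le_one).mp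
      (intervalIntegrable_superlevel b u 0 1)

/-- For `0 < t ≤ 1` the value of the `j`-th function at `b {u ≥ t}` is nonnegative and vanishes
exactly when `t ≤ u j`. -/
theorem layerIntegral_eq_zero_iff (h : IsBarycentricSystem Q f c K b) {u : V → ℝ}
    (hu : u ∈ layerDomain K) (j : V) : f j (layerIntegral b u) + c j = 0 ↔ u j = 1 := by
  rw [map_layerIntegral]
  have key := fun t (ht : 0 < t) => superlevel_mem h.subset_mem hu ht
  constructor
  · intro h0
    by_contra hne
    refine (layerIntegral_pos (hu.1 j).1 (lt_of_le_of_ne (hu.1 j).2 hne) (fun t ht _ => ?_)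
      fun t ht _ hj => ?_).ne' h0
    · exact h.nonneg _ (h.mem _ (key t ht)) j
    · exact lt_of_le_of_ne (h.nonneg _ (h.mem _ (key t ht)) j)
        fun h' => hj ((h.eq_zero_iff _ (key t ht) j).mp h'.symm)
  · exact fun h1 => layerIntegral_eq_zero h1.ge fun t ht _ hj =>
      (h.eq_zero_iff _ (key t ht) j).mpr hj

open Classical in
/-- Every point of the domain other than `1_σ` lies on a segment from `1_σ` to a point with a
larger set of coordinates equal to one. -/
theorem exists_scale {u : V → ℝ} (hu : u ∈ layerDomain K) {σ : Finset V}
    (hσ : ∀ i, i ∈ σ ↔ u i = 1) :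
    u = (fun i => if i ∈ σ then 1 else 0) ∨
    ∃ s ∈ Ioo (0 : ℝ) 1, ∃ v ∈ layerDomain K, (∀ i ∈ σ, v i = 1) ∧ (∃ j ∉ σ, v j = 1) ∧
      u = fun i => if i ∈ σ then 1 else s * v i := by
  by_cases hne : ∃ i ∉ σ, u i ≠ 0
  · right
    obtain ⟨i₀, hi₀, hi₀'⟩ := hne
    -- The scale `s` is the largest coordinate outside `σ`; dividing by it makes that coordinate
    -- equal to one.
    obtain ⟨j, hj, hmax⟩ := (Finset.univ.filter (· ∉ σ)).exists_max_image u ⟨i₀, by simpa using hi₀⟩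
    simp only [Finset.mem_filter, Finset.mem_univ, true_and] at hj hmax
    have hj0 : 0 < u j := ((hu.1 i₀).1.lt_of_ne hi₀'.symm).trans_le (hmax _ hi₀)
    have hj1 : u j < 1 := (hu.1 j).2.lt_of_ne fun h => hj ((hσ j).mpr h)
    refine ⟨u j, ⟨hj0, hj1⟩, fun i => if i ∈ σ then 1 else u i / u j, ⟨fun i => ?_, ?_⟩, ?_,
      ⟨j, hj, by simp [hj, hj0.ne']⟩, ?_⟩
    · dsimp only
      split_ifs with hi
      · simp
      · exact ⟨div_nonneg (hu.1 i).1 hj0.le, (div_le_one hj0).mpr (hmax i hi)⟩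
    · obtain ⟨τ, hτ, h0⟩ := hu.2
      refine ⟨τ, hτ, fun i hi => ?_⟩
      have : i ∉ σ := fun h => by
        have := (hσ i).mp h
        rw [h0 i hi] at this
        exact zero_ne_one this
      simp [this, h0 i hi]
    · intro i hi
      simp [hi]
    · ext i
      split_ifs with hi
      · exact (hσ i).mp hi
      · simp only [if_neg hi]
        field_simp
  · left
    push Not at hne
    ext i
    split_ifs with hi
    · exact (hσ i).mp hi
    · exact hne i hi

-- The hypothesis says that `y` lies on the segment from `b σ` to `x` and differs from `x` unless
-- all three coincide. A function vanishing at `y` is nonnegative at both ends and has positive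
-- weight at `b σ`, so it vanishes at `b σ`.
omit [CompleteSpace E] in
theorem line_zero_subset (h : IsBarycentricSystem Q f c K b) {σ : Finset V} (hσ : σ ∈ K) {x y : E}
    (hx : x ∈ Q) {r s : ℝ} (hr : 0 ≤ r) (hrs : r < s)
    (hxy : r • (x - b σ) = s • (y - b σ)) : ∀ j, f j y + c j = 0 → j ∈ σ := by
  intro j hj
  have hs : 0 < s := hr.trans_lt hrs
  have hy : y = b σ + (r / s) • (x - b σ) := by
    rw [div_eq_inv_mul, mul_smul, hxy, smul_smul, inv_mul_cancel₀ hs.ne', one_smul]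
    abel
  rw [hy, affine_line] at hj
  have h1 := h.nonneg x hx j
  have h2 := h.nonneg _ (h.mem σ hσ) j
  have h3 : 0 ≤ r / s := by positivity
  have h4 : 0 < 1 - r / s := by
    rw [sub_pos, div_lt_one hs]
    exact hrs
  rw [← h.eq_zero_iff σ hσ j]
  have h5 : 0 ≤ r / s * (f j x + c j) := by positivity
  have h6 : 0 ≤ (1 - r / s) * (f j (b σ) + c j) := by positivity
  have h7 : (1 - r / s) * (f j (b σ) + c j) = 0 := by linarith
  exact (mul_eq_zero.mp h7).resolve_left h4.ne'

theorem injOn (h : IsBarycentricSystem Q f c K b) :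
    InjOn (layerIntegral b) (layerDomain K) := by
  classical
  -- Induction on the number of coordinates different from one. The set `σ` of coordinates equal to
  -- one can be read off from the image point, so it is the same for `u` and `v`.
  suffices H : ∀ (N : ℕ) (u v : V → ℝ) (σ : Finset V), u ∈ layerDomain K → v ∈ layerDomain K →
      layerIntegral b u = layerIntegral b v → (∀ i, i ∈ σ ↔ u i = 1) →
      Fintype.card V - σ.card ≤ N → u = v by
    intro u hu v hv huv
    exact H _ u v (Finset.univ.filter fun i => u i = 1) hu hv huv (by simp) le_rfl
  intro N
  induction N with
  | zero =>
    intro u v σ hu hv huv hσ hN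
    have hσu : σ = Finset.univ :=
      Finset.eq_univ_of_card σ (le_antisymm σ.card_le_univ (by lia))
    ext i
    have hu1 : u i = 1 := (hσ i).mp (by simp [hσu])
    rw [hu1, eq_comm, ← h.layerIntegral_eq_zero_iff hv, ← huv, h.layerIntegral_eq_zero_iff hu, hu1]
  | succ N ih =>
    intro u v σ hu hv huv hσ hN
    have hσv : ∀ i, i ∈ σ ↔ v i = 1 := fun i => by
      rw [hσ, ← h.layerIntegral_eq_zero_iff hu, huv, h.layerIntegral_eq_zero_iff hv]
    have hσK : σ ∈ K := by
      have : σ = superlevel u 1 := by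
        ext i
        rw [hσ, mem_superlevel]
        exact ⟨fun h => h.ge, fun h => le_antisymm (hu.1 i).2 h⟩
      rw [this]
      exact superlevel_mem h.subset_mem hu one_pos
    have step : ∀ s ∈ Ioo (0 : ℝ) 1, ∀ w ∈ layerDomain K, (∀ i ∈ σ, w i = 1) →
        layerIntegral b (fun i => if i ∈ σ then 1 else s * w i) - b σ =
          s • (layerIntegral b w - b σ) := by
      intro s hs w hw hw1
      rw [layerIntegral_scale b ⟨hs.1.le, hs.2.le⟩ hw1 fun i => (hw.1 i).2]
      module
    rcases exists_scale hu hσ with hu' | ⟨s, hs, u', hu', hu'σ, ⟨j, hj, hju⟩, hus⟩ <;>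
    rcases exists_scale hv hσv with hv' | ⟨r, hr, v', hv', hv'σ, ⟨k, hk, hkv⟩, hvr⟩
    · rw [hu', hv']
    · refine absurd (h.line_zero_subset hσK (h.layerIntegral_mem hu) le_rfl hr.1
        (y := layerIntegral b v') ?_ k ((h.layerIntegral_eq_zero_iff hv' k).mpr hkv)) hk
      rw [← step r hr v' hv' hv'σ, ← hvr, ← huv, hu', layerIntegral_indicator]
      simp
    · refine absurd (h.line_zero_subset hσK (h.layerIntegral_mem hv) le_rfl hs.1
        (y := layerIntegral b u') ?_ j ((h.layerIntegral_eq_zero_iff hu' j).mpr hju)) hj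
      rw [← step s hs u' hu' hu'σ, ← hus, huv, hv', layerIntegral_indicator]
      simp
    · have key : s • (layerIntegral b u' - b σ) = r • (layerIntegral b v' - b σ) := by
        rw [← step s hs u' hu' hu'σ, ← step r hr v' hv' hv'σ, ← hus, ← hvr, huv]
      -- If the scales differ, the image of `u'` or `v'` at the larger scale has no sharp inequality
      -- outside `σ`, although that point has an additional coordinate equal to one.
      rcases lt_trichotomy s r with hsr | rfl | hsr
      · exact absurd (h.line_zero_subset hσK (h.layerIntegral_mem hu') hs.1.le hsr key k
          ((h.layerIntegral_eq_zero_iff hv' k).mpr hkv)) hk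
      · have huv' : layerIntegral b u' = layerIntegral b v' := by
          have := smul_right_injective E hs.1.ne' key
          simpa using this
        have : u' = v' := by
          refine ih u' v' (Finset.univ.filter fun i => u' i = 1) hu' hv' huv' (by simp) ?_
          have : σ.card < (Finset.univ.filter fun i => u' i = 1).card := by
            refine Finset.card_lt_card ⟨fun i hi => by simpa using hu'σ i hi, fun hs => hj ?_⟩
            exact hs (by simpa using hju)
          lia
        rw [hus, hvr, this]
      · exact absurd (h.line_zero_subset hσK (h.layerIntegral_mem hv') hr.1.le hsr key.symm j
          ((h.layerIntegral_eq_zero_iff hu' j).mpr hju)) hj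

omit [CompleteSpace E] in
/-- The ray from `b σ` through a point `x` with `σ ⊆ zeroSet x` leaves `Q` at a point with a larger
set of sharp inequalities. -/
theorem exists_exit (h : IsBarycentricSystem Q f c K b) {σ : Finset V} (hσ : σ ∈ K) {x : E}
    (hx : x ∈ Q) (hσx : σ ⊆ zeroSet f c x) (hne : x ≠ b σ) :
    ∃ r : ℝ, 1 ≤ r ∧ ∃ y ∈ Q, σ ⊂ zeroSet f c y ∧ y = b σ + r • (x - b σ) := by
  have hd : 0 < ‖x - b σ‖ := norm_pos_iff.mpr (sub_ne_zero.mpr hne)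
  have hbQ := h.mem σ hσ
  set γ : ℝ → E := fun r => b σ + r • (x - b σ) with hγ
  have hγc : Continuous γ := by fun_prop
  obtain ⟨C, hC⟩ := h.isCompact.isBounded.exists_norm_le
  have hcomp : IsCompact {r : ℝ | 0 ≤ r ∧ γ r ∈ Q} := by
    refine (isCompact_Icc (a := (0 : ℝ)) (b := (C + C) / ‖x - b σ‖)).of_isClosed_subset
      (isClosed_Ici.inter (h.isCompact.isClosed.preimage hγc)) ?_
    rintro r ⟨hr0, hr⟩
    refine ⟨hr0, ?_⟩
    rw [le_div_iff₀ hd]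
    calc r * ‖x - b σ‖ = ‖γ r - b σ‖ := by simp [hγ, norm_smul, abs_of_nonneg hr0]
      _ ≤ ‖γ r‖ + ‖b σ‖ := norm_sub_le _ _
      _ ≤ C + C := add_le_add (hC _ hr) (hC _ hbQ)
  have h1mem : (1 : ℝ) ∈ {r : ℝ | 0 ≤ r ∧ γ r ∈ Q} := by simp [hγ, hx]
  -- The last parameter in `Q`. If no new inequality were sharp there, all those outside `σ` would
  -- be strict and the ray could be followed further.
  obtain ⟨r, ⟨hr0, hrQ⟩, hmax⟩ := hcomp.exists_isGreatest ⟨1, h1mem⟩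
  have hzero : ∀ s, ∀ j ∈ σ, f j (γ s) + c j = 0 := by
    intro s j hj
    rw [hγ, affine_line, (h.eq_zero_iff σ hσ j).mpr hj, mem_zeroSet.mp (hσx hj)]
    simp
  refine ⟨r, hmax h1mem, γ r, hrQ, ⟨fun j hj => mem_zeroSet.mpr (hzero r j hj), fun hsub => ?_⟩,
    rfl⟩
  have hev : ∀ᶠ s in 𝓝 r, ∀ j, 0 ≤ f j (γ s) + c j := by
    refine eventually_all.mpr fun j => ?_
    by_cases hj : j ∈ σ
    · exact Eventually.of_forall fun s => (hzero s j hj).ge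
    · have hpos : 0 < f j (γ r) + c j := by
        refine (h.nonneg _ hrQ j).lt_of_ne fun h0 => hj (hsub ?_)
        exact mem_zeroSet.mpr h0.symm
      have hc : Continuous fun s => f j (γ s) + c j := by fun_prop
      exact (hc.continuousAt.eventually (lt_mem_nhds hpos)).mono fun _ => le_of_lt
  have hev' : ∀ᶠ s in 𝓝[>] r, r < s ∧ ∀ j, 0 ≤ f j (γ s) + c j :=
    eventually_mem_nhdsWithin.and (hev.filter_mono nhdsWithin_le_nhds)
  obtain ⟨s, hrs, hs⟩ := hev'.exists
  exact hrs.not_ge (hmax ⟨hr0.trans hrs.le, h.line_mem _ hbQ _ hx s hs⟩)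

theorem surjOn (h : IsBarycentricSystem Q f c K b) :
    SurjOn (layerIntegral b) (layerDomain K) Q := by
  classical
  suffices H : ∀ (N : ℕ) (σ : Finset V) (x : E), Fintype.card V - σ.card ≤ N → σ ∈ K → x ∈ Q →
      σ ⊆ zeroSet f c x → ∃ u ∈ layerDomain K, (∀ i ∈ σ, u i = 1) ∧ layerIntegral b u = x by
    intro x hx
    obtain ⟨u, hu, -, hux⟩ := H _ _ x le_rfl (h.zeroSet_mem x hx) hx subset_rfl
    exact ⟨u, hu, hux⟩
  intro N
  induction N with
  | zero =>
    intro σ x hN hσ hx hσx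
    by_cases hxb : x = b σ
    · exact ⟨_, indicator_mem_layerDomain hσ, fun i hi => by simp [hi],
        (layerIntegral_indicator b σ).trans hxb.symm⟩
    · obtain ⟨r, -, y, -, hy, -⟩ := h.exists_exit hσ hx hσx hxb
      have := Finset.card_lt_card hy
      have := (zeroSet f c y).card_le_univ
      lia
  | succ N ih =>
    intro σ x hN hσ hx hσx
    by_cases hxb : x = b σ
    · exact ⟨_, indicator_mem_layerDomain hσ, fun i hi => by simp [hi],
        (layerIntegral_indicator b σ).trans hxb.symm⟩
    · obtain ⟨r, hr, y, hyQ, hy, hyr⟩ := h.exists_exit hσ hx hσx hxb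
      have hcard := Finset.card_lt_card hy
      -- The exit point `y` is the image of some `v`. Since `x` is at the fraction `1/r` of the way
      -- from `b σ` to `y`, it is the image of `v` scaled by `1/r` outside `σ`.
      obtain ⟨v, hv, hv1, hvy⟩ := ih (zeroSet f c y) y (by lia) (h.zeroSet_mem y hyQ) hyQ subset_rfl
      have hr0 : 0 < r := by linarith
      have hr1 : r⁻¹ ≤ 1 := inv_le_one_of_one_le₀ hr
      have hr2 : 0 ≤ r⁻¹ := by positivity
      refine ⟨fun i => if i ∈ σ then 1 else r⁻¹ * v i, ⟨fun i => ?_, ?_⟩, fun i hi => by simp [hi], ?_⟩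
      · dsimp only
        split_ifs
        · simp
        · exact ⟨mul_nonneg hr2 (hv.1 i).1, mul_le_one₀ hr1 (hv.1 i).1 (hv.1 i).2⟩
      · obtain ⟨τ, hτ, h0⟩ := hv.2
        refine ⟨τ, hτ, fun i hi => ?_⟩
        have : i ∉ σ := fun h => by
          have := hv1 i (hy.1 h)
          rw [h0 i hi] at this
          exact zero_ne_one this
        simp [this, h0 i hi]
      · rw [layerIntegral_scale b ⟨hr2, hr1⟩ (fun i hi => hv1 i (hy.1 hi)) fun i => (hv.1 i).2,
          hvy, hyr, smul_add, smul_smul, inv_mul_cancel₀ hr0.ne']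
        module

theorem bijOn (h : IsBarycentricSystem Q f c K b) :
    BijOn (layerIntegral b) (layerDomain K) Q :=
  ⟨fun _ hu => h.layerIntegral_mem hu, h.injOn, h.surjOn⟩

end IsBarycentricSystem

end Barycentric

/-! ### Faces of sets given by affine inequalities -/

section Inequalities

open Set Filter Topology

variable {V E : Type} [NormedAddCommGroup E] [NormedSpace ℝ E]

/-- The solutions of the inequalities `0 ≤ f j + c j` which are sharp for `j ∈ σ`. -/
def faceSet (f : V → E →L[ℝ] ℝ) (c : V → ℝ) (σ : Finset V) : Set E :=
  {x | (∀ j, 0 ≤ f j x + c j) ∧ ∀ j ∈ σ, f j x + c j = 0}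

variable {f : V → E →L[ℝ] ℝ} {c : V → ℝ}

theorem faceSet_anti {σ τ : Finset V} (h : σ ⊆ τ) : faceSet f c τ ⊆ faceSet f c σ :=
  fun _ hx => ⟨hx.1, fun j hj => hx.2 j (h hj)⟩

theorem affine_add_smul (f : V → E →L[ℝ] ℝ) (c : V → ℝ) (j : V) (x w : E) (r : ℝ) :
    f j (x + r • w) + c j = f j x + c j + r * f j w := by
  simp only [map_add, map_smul, smul_eq_mul]
  ring

theorem convex_faceSet (f : V → E →L[ℝ] ℝ) (c : V → ℝ) (σ : Finset V) :
    Convex ℝ (faceSet f c σ) := by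
  intro x hx y hy p q hp hq hpq
  have h : ∀ j, f j (p • x + q • y) + c j = p * (f j x + c j) + q * (f j y + c j) := fun j => by
    obtain rfl : p = 1 - q := by linarith
    simp only [map_add, map_smul, smul_eq_mul]
    ring
  refine ⟨fun j => ?_, fun j hj => ?_⟩
  · rw [h]
    have := hx.1 j
    have := hy.1 j
    positivity
  · rw [h, hx.2 j hj, hy.2 j hj]
    simp

theorem isClosed_faceSet (f : V → E →L[ℝ] ℝ) (c : V → ℝ) (σ : Finset V) :
    IsClosed (faceSet f c σ) := by
  have : faceSet f c σ = (⋂ j, {x | 0 ≤ f j x + c j}) ∩ ⋂ j ∈ σ, {x | f j x + c j = 0} := by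
    ext x
    simp [faceSet]
  rw [this]
  refine (isClosed_iInter fun j => ?_).inter (isClosed_biInter fun j _ => ?_)
  · exact isClosed_le continuous_const (by fun_prop)
  · exact isClosed_eq (by fun_prop) continuous_const

/-- The vector span of a set which contains a neighbourhood of one of its points in a subspace. -/
theorem vectorSpan_eq_of_forall {G : Set E} {W : Submodule ℝ E} {y : E} (hy : y ∈ G)
    (hG : ∀ x ∈ G, x - y ∈ W) (hW : ∀ w ∈ W, ∃ r : ℝ, r ≠ 0 ∧ y + r • w ∈ G) :
    vectorSpan ℝ G = W := by
  apply le_antisymm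
  · rw [vectorSpan_eq_span_vsub_set_right ℝ hy, Submodule.span_le]
    rintro _ ⟨x, hx, rfl⟩
    exact hG x hx
  · intro w hw
    obtain ⟨r, hr, hrw⟩ := hW w hw
    have h := vsub_mem_vectorSpan ℝ hrw hy
    have h' : y + r • w -ᵥ y = r • w := by simp
    rw [h'] at h
    exact (Submodule.smul_mem_iff _ hr).mp h

variable [Fintype V]

/-- Starting at a solution, one may move a little in every direction in which the sharp inequalities
are preserved. -/
theorem exists_move {x : E} (hx : ∀ j, 0 ≤ f j x + c j) (w : E)
    (hw : ∀ j, f j x + c j = 0 → 0 ≤ f j w) :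
    ∃ r : ℝ, 0 < r ∧ (∀ j, 0 ≤ f j (x + r • w) + c j) ∧
      ∀ j, 0 < f j x + c j → 0 < f j (x + r • w) + c j := by
  have h : ∀ᶠ r in 𝓝[>] (0 : ℝ), 0 < r ∧ ∀ j, 0 < f j x + c j → 0 < f j (x + r • w) + c j := by
    refine eventually_mem_nhdsWithin.and (eventually_all.mpr fun j => ?_)
    rcases (hx j).eq_or_lt with h0 | h0
    · exact Eventually.of_forall fun r hr => absurd h0 hr.ne
    · have hc : Continuous fun r : ℝ => f j (x + r • w) + c j := by fun_prop
      have h1 : ∀ᶠ r in 𝓝 (0 : ℝ), 0 < f j (x + r • w) + c j :=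
        hc.continuousAt.eventually (lt_mem_nhds (by simpa using h0))
      exact (h1.filter_mono nhdsWithin_le_nhds).mono fun r hr _ => hr
  obtain ⟨r, hr, h⟩ := h.exists
  refine ⟨r, hr, fun j => ?_, h⟩
  rcases (hx j).eq_or_lt with h0 | h0
  · rw [affine_add_smul, ← h0, zero_add]
    exact mul_nonneg hr.le (hw j h0.symm)
  · exact (h j h0).le

omit [Fintype V] in
theorem mem_iInf_ker {σ : Finset V} {w : E} :
    w ∈ (⨅ j ∈ σ, LinearMap.ker (f j : E →ₗ[ℝ] ℝ)) ↔ ∀ j ∈ σ, f j w = 0 := by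
  simp [Submodule.mem_iInf]

/-- Since no inequality outside `σ` is sharp at `z`, a small move from `z` in any direction of the
common kernel stays in the face. -/
theorem vectorSpan_faceSet {σ : Finset V} {z : E} (hz : ∀ j, 0 ≤ f j z + c j)
    (hσ : zeroSet f c z = σ) :
    vectorSpan ℝ (faceSet f c σ) = ⨅ j ∈ σ, LinearMap.ker (f j : E →ₗ[ℝ] ℝ) := by
  have hσ' : ∀ j, j ∈ σ ↔ f j z + c j = 0 := by
    rintro j
    rw [← hσ, mem_zeroSet]
  refine vectorSpan_eq_of_forall (y := z) ⟨hz, fun j hj => (hσ' j).mp hj⟩ (fun x hx => ?_) ?_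
  · rw [mem_iInf_ker]
    intro j hj
    have h1 := hx.2 j hj
    have h2 := (hσ' j).mp hj
    rw [map_sub]
    linarith
  · intro w hw
    rw [mem_iInf_ker] at hw
    obtain ⟨r, hr, h, -⟩ := exists_move hz w fun j hj => (hw j ((hσ' j).mpr hj)).ge
    refine ⟨r, hr.ne', h, fun j hj => ?_⟩
    rw [affine_add_smul, hw j hj, (hσ' j).mp hj]
    simp

/-- A convex set on which the functions `f j + c j` are nonnegative has a point at which only those
of them vanish that vanish identically on the set. -/
theorem exists_generic {G : Set E} (hG : Convex ℝ G) (hne : G.Nonempty)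
    (hnn : ∀ x ∈ G, ∀ j, 0 ≤ f j x + c j) :
    ∃ z ∈ G, ∀ j, f j z + c j = 0 → ∀ x ∈ G, f j x + c j = 0 := by
  classical
  suffices H : ∀ S : Finset V, ∃ z ∈ G, ∀ j ∈ S, f j z + c j = 0 → ∀ x ∈ G, f j x + c j = 0 by
    obtain ⟨z, hz, h⟩ := H Finset.univ
    exact ⟨z, hz, fun j => h j (Finset.mem_univ j)⟩
  intro S
  induction S using Finset.induction_on with
  | empty =>
    obtain ⟨z, hz⟩ := hne
    exact ⟨z, hz, by simp⟩
  | insert i S _ ih =>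
    obtain ⟨z, hz, h⟩ := ih
    by_cases hi : ∀ x ∈ G, f i x + c i = 0
    · refine ⟨z, hz, fun j hj => ?_⟩
      rcases Finset.mem_insert.mp hj with rfl | hj
      · exact fun _ => hi
      · exact h j hj
    · push Not at hi
      obtain ⟨x, hx, hxi⟩ := hi
      have hmid : ∀ j, f j (z + (1 / 2 : ℝ) • (x - z)) + c j =
          (1 / 2) * (f j z + c j) + (1 / 2) * (f j x + c j) := fun j => by
        rw [affine_line]
        ring
      -- A nonnegative affine function vanishes at a midpoint only if it vanishes at both ends.
      refine ⟨z + (1 / 2 : ℝ) • (x - z), hG.add_smul_sub_mem hz hx (by norm_num), fun j hj h0 => ?_⟩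
      rw [hmid] at h0
      have h1 := hnn z hz j
      have h2 := hnn x hx j
      rcases Finset.mem_insert.mp hj with rfl | hj
      · exact absurd (by linarith) hxi
      · exact h j hj (by linarith)

/-- An exposed face of a face consists of the solutions for which certain inequalities are sharp,
namely those that are sharp at a generic point. -/
theorem exists_eq_faceSet {σ : Finset V} {G : Set E} (hG : IsFace (faceSet f c σ) G) :
    ∃ τ : Finset V, σ ⊆ τ ∧ G = faceSet f c τ ∧ ∃ z, (∀ j, 0 ≤ f j z + c j) ∧ zeroSet f c z = τ := by
  obtain ⟨hne, hexp⟩ := hG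
  obtain ⟨l, hl⟩ := hexp hne
  obtain ⟨z, hz, hgen⟩ := exists_generic (f := f) (c := c)
    (hexp.convex (convex_faceSet f c σ)) hne fun x hx => (hexp.subset hx).1
  have hzσ := hexp.subset hz
  refine ⟨zeroSet f c z, fun j hj => mem_zeroSet.mpr (hzσ.2 j hj), ?_, z, hzσ.1, rfl⟩
  ext x
  refine ⟨fun hx => ⟨(hexp.subset hx).1, fun j hj => hgen j (mem_zeroSet.mp hj) x hx⟩, fun hx => ?_⟩
  have hx0 : ∀ j, f j z + c j = 0 → f j (z - x) = 0 := fun j hj => by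
    have := hx.2 j (mem_zeroSet.mpr hj)
    rw [map_sub]
    linarith
  -- The segment from `x` to the generic point `z` can be prolonged beyond `z` inside the face. As
  -- `l` is maximal at `z`, it cannot be smaller at `x`.
  obtain ⟨r, hr, hmem, -⟩ := exists_move hzσ.1 (z - x) fun j hj => (hx0 j hj).ge
  have hy : z + r • (z - x) ∈ faceSet f c σ := by
    refine ⟨hmem, fun j hj => ?_⟩
    rw [affine_add_smul, hx0 j (hzσ.2 j hj), hzσ.2 j hj]
    simp
  have hxσ : x ∈ faceSet f c σ :=
    ⟨hx.1, fun j hj => hx.2 j (mem_zeroSet.mpr (hzσ.2 j hj))⟩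
  rw [hl] at hz ⊢
  refine ⟨hxσ, fun y' hy' => (hz.2 y' hy').trans ?_⟩
  have h1 := hz.2 _ hy
  simp only [map_add, map_smul, map_sub, smul_eq_mul] at h1
  nlinarith

-- Minus the sum of the functions of `τ` is at most zero on the larger face, with equality exactly
-- on the smaller one.
omit [Fintype V] in
theorem isExposed_faceSet {σ τ : Finset V} (h : σ ⊆ τ) :
    IsExposed ℝ (faceSet f c σ) (faceSet f c τ) := by
  classical
  rintro ⟨x₀, hx₀⟩
  refine ⟨-∑ j ∈ τ, f j, ?_⟩
  have key : ∀ x, (-∑ j ∈ τ, f j) x = -∑ j ∈ τ, (f j x + c j) + ∑ j ∈ τ, c j := fun x => by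
    simp [Finset.sum_add_distrib]
  ext x
  simp only [mem_ofPred_eq, key, add_le_add_iff_right, neg_le_neg_iff]
  constructor
  · intro hx
    refine ⟨faceSet_anti h hx, fun y hy => ?_⟩
    rw [Finset.sum_eq_zero hx.2]
    exact Finset.sum_nonneg fun j _ => hy.1 j
  · rintro ⟨hx, hmax⟩
    refine ⟨hx.1, ?_⟩
    have h1 := hmax x₀ (faceSet_anti h hx₀)
    rw [Finset.sum_eq_zero hx₀.2] at h1
    exact (Finset.sum_eq_zero_iff_of_nonneg fun j _ => hx.1 j).mp
      (le_antisymm h1 (Finset.sum_nonneg fun j _ => hx.1 j))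

omit [Fintype V] in
theorem isExtreme_faceSet {P : Set E} (hP : P = {x | ∀ j, 0 ≤ f j x + c j}) (σ : Finset V) :
    IsExtreme ℝ P (faceSet f c σ) := by
  have h0 : faceSet f c ∅ = P := by
    ext x
    simp [hP, faceSet]
  rw [← h0]
  exact (isExposed_faceSet (Finset.empty_subset σ)).isExtreme

/-- At an extreme point, a vector killed by all the sharp functionals vanishes. -/
theorem eq_zero_of_mem_extremePoints {P : Set E} (hP : P = {x | ∀ j, 0 ≤ f j x + c j}) {v : E}
    (hv : v ∈ P.extremePoints ℝ) {w : E} (hw : ∀ j, f j v + c j = 0 → f j w = 0) : w = 0 := by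
  have hvP : ∀ j, 0 ≤ f j v + c j := by
    have := hv.1
    rwa [hP] at this
  obtain ⟨r, hr, h1, -⟩ := exists_move hvP w fun j hj => (hw j hj).ge
  obtain ⟨s, hs, h2, -⟩ := exists_move hvP (-w) fun j hj => by simp [hw j hj]
  have := hv.2 (x₁ := v + r • w) (by rwa [hP]) (x₂ := v + s • (-w)) (by rwa [hP]) ?_
  · have h3 : r • w = 0 := by simpa using this
    exact (smul_eq_zero.mp h3).resolve_left hr.ne'
  -- These weights make the displacements `r • w` and `-s • w` cancel.
  · refine ⟨s / (r + s), r / (r + s), by positivity, by positivity, ?_, ?_⟩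
    · field_simp
      ring
    · have h4 : s / (r + s) + r / (r + s) = 1 := by field_simp; ring
      have h5 : s / (r + s) * r = r / (r + s) * s := by ring
      calc (s / (r + s)) • (v + r • w) + (r / (r + s)) • (v + s • -w)
          = (s / (r + s) + r / (r + s)) • v + (s / (r + s) * r - r / (r + s) * s) • w := by module
        _ = v := by rw [h4, h5]; simp

end Inequalities

/-! ### Presentations of polytopes by their facets -/

section Presentation

open Set Filter Topology

/-- Take an index set minimal among those defining the same solutions. If every point violating
inequality `i` also violated another one, `i` could be dropped. -/
theorem exists_irredundant {ι E : Type} [Finite ι] [NormedAddCommGroup E] [NormedSpace ℝ E]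
    (f : ι → E →L[ℝ] ℝ) (c : ι → ℝ) :
    ∃ I : Set ι, {x | ∀ i, 0 ≤ f i x + c i} = {x | ∀ i ∈ I, 0 ≤ f i x + c i} ∧
      ∀ i ∈ I, ∃ x, f i x + c i < 0 ∧ ∀ j ∈ I, j ≠ i → 0 ≤ f j x + c j := by
  obtain ⟨I, hI, hmin⟩ := exists_minimal_of_wellFoundedLT
    (fun I : Set ι => {x | ∀ i, 0 ≤ f i x + c i} = {x | ∀ i ∈ I, 0 ≤ f i x + c i})
    ⟨univ, by simp⟩
  refine ⟨I, hI, fun i hi => ?_⟩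
  by_contra! h
  have hlt : {x | ∀ i, 0 ≤ f i x + c i} = {x | ∀ j ∈ I \ {i}, 0 ≤ f j x + c j} := by
    rw [hI]
    ext x
    refine ⟨fun hx j hj => hx j hj.1, fun hx => ?_⟩
    have hi0 : 0 ≤ f i x + c i := by
      by_contra! hneg
      obtain ⟨j, hj, hji, hlt⟩ := h x hneg
      exact hlt.not_ge (hx j ⟨hj, hji⟩)
    intro j hj
    by_cases hji : j = i
    · rwa [hji]
    · exact hx j ⟨hj, hji⟩
  exact (hmin hlt sdiff_subset hi).2 rfl

variable {V E : Type} [NormedAddCommGroup E] [NormedSpace ℝ E]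

/-- A nonnegative affine function vanishing at an interior point is nonnegative along both
directions of every line through it, so its linear part is zero. -/
theorem pos_of_mem_interior {f : V → E →L[ℝ] ℝ} {c : V → ℝ} {P : Set E}
    (hP : P = {x | ∀ j, 0 ≤ f j x + c j}) {p : E} (hp : p ∈ interior P) {j : V} (hj : f j ≠ 0) :
    0 < f j p + c j := by
  have hnn : ∀ x ∈ P, 0 ≤ f j x + c j := by
    intro x hx
    rw [hP] at hx
    exact hx j
  refine (hnn p (interior_subset hp)).lt_of_ne fun h0 => hj ?_
  ext w
  have hc : Continuous fun r : ℝ => p + r • w := by fun_prop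
  have h1 : ∀ᶠ r in 𝓝 (0 : ℝ), p + r • w ∈ P :=
    hc.continuousAt.eventually (by simpa using mem_interior_iff_mem_nhds.mp hp)
  have h2 : ∀ᶠ r in 𝓝 (0 : ℝ), 0 ≤ r * f j w := h1.mono fun r hr => by
    have := hnn _ hr
    rwa [affine_add_smul, ← h0, zero_add] at this
  obtain ⟨r, hr, hr0⟩ := ((h2.filter_mono nhdsWithin_le_nhds).and
    (eventually_mem_nhdsWithin (a := (0 : ℝ)) (s := Ioi 0))).exists
  obtain ⟨s, hs, hs0⟩ := ((h2.filter_mono nhdsWithin_le_nhds).and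
    (eventually_mem_nhdsWithin (a := (0 : ℝ)) (s := Iio 0))).exists
  have h3 : 0 ≤ f j w := nonneg_of_mul_nonneg_right hr hr0
  have h4 : f j w ≤ 0 := by
    by_contra! h
    exact (mul_neg_of_neg_of_pos hs0 h).not_ge hs
  simpa using le_antisymm h4 h3

theorem finrank_ker_add_one [FiniteDimensional ℝ E] {g : E →L[ℝ] ℝ} (hg : g ≠ 0) :
    Module.finrank ℝ (LinearMap.ker (g : E →ₗ[ℝ] ℝ)) + 1 = Module.finrank ℝ E :=
  Module.Dual.finrank_ker_add_one_of_ne_zero (f := (g : E →ₗ[ℝ] ℝ))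
    fun h => hg (ContinuousLinearMap.ext fun w => LinearMap.congr_fun h w)

theorem setDim_of_interior_nonempty {P : Set E} (h : (interior P).Nonempty) :
    setDim P = Module.finrank ℝ E := by
  have h1 : affineSpan ℝ P = ⊤ := affineSpan_eq_top_of_nonempty_interior
    (h.mono (interior_mono (subset_convexHull ℝ P)))
  have h2 : vectorSpan ℝ P = ⊤ := by
    rw [← direction_affineSpan, h1, AffineSubspace.direction_top]
  rw [setDim, h2, finrank_top]

/-- The sets cut out by the inequalities of an irredundant system are the facets. -/
theorem bijective_facets_of_irredundant [Finite V] [FiniteDimensional ℝ E] {f : V → E →L[ℝ] ℝ}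
    {c : V → ℝ} {P : Set E} (hP : P = {x | ∀ j, 0 ≤ f j x + c j}) (hint : (interior P).Nonempty)
    (hirr : ∀ i, ∃ x, f i x + c i < 0 ∧ ∀ j, j ≠ i → 0 ≤ f j x + c j) :
    ∃ e : V ≃ Facet P, ∀ j, (e j : Set E) = {x ∈ P | f j x + c j = 0} := by
  have := Fintype.ofFinite V
  obtain ⟨p, hp⟩ := hint
  have hpP : ∀ j, 0 ≤ f j p + c j := by
    have := interior_subset hp
    rwa [hP] at this
  have hf : ∀ j, f j ≠ 0 := by
    intro j h0
    obtain ⟨x, hx, -⟩ := hirr j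
    have := hpP j
    simp only [h0, zero_apply] at hx this
    exact hx.not_ge this
  have hpos : ∀ j, 0 < f j p + c j := fun j => pos_of_mem_interior hP hp (hf j)
  have hgen : ∀ i, ∃ y, (∀ j, 0 ≤ f j y + c j) ∧ ∀ j, f j y + c j = 0 ↔ j = i := by
    intro i
    -- The segment from `x`, which violates only inequality `i`, to the interior point `p` crosses
    -- the hyperplane of `i` at parameter `-b / (a - b)`. All the other functions are positive
    -- there.
    obtain ⟨x, hx, hxj⟩ := hirr i
    set a := f i p + c i
    set b := f i x + c i
    have ha : 0 < a := hpos i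
    have hab : 0 < a - b := by linarith
    have hval : ∀ j, f j (x + (-b / (a - b)) • (p - x)) + c j =
        (a / (a - b)) * (f j x + c j) + (-b / (a - b)) * (f j p + c j) := fun j => by
      rw [affine_line]
      congr 2
      field_simp
      ring
    have hb : 0 < -b / (a - b) := div_pos (by linarith) hab
    have hi0 : f i (x + (-b / (a - b)) • (p - x)) + c i = 0 := by
      rw [hval]
      change a / (a - b) * b + -b / (a - b) * a = 0
      ring
    have hj0 : ∀ j, j ≠ i → 0 < f j (x + (-b / (a - b)) • (p - x)) + c j := by
      intro j hj
      rw [hval]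
      have := hxj j hj
      have := hpos j
      positivity
    refine ⟨x + (-b / (a - b)) • (p - x), fun j => ?_, fun j => ⟨fun h => ?_, fun h => ?_⟩⟩
    · by_cases hj : j = i
      · rw [hj, hi0]
      · exact (hj0 j hj).le
    · by_contra hj
      exact (hj0 j hj).ne' h
    · rw [h, hi0]
  choose y hy hyi using hgen
  have hzero : ∀ i, zeroSet f c (y i) = {i} := fun i => by
    ext j
    simp [hyi]
  have hface : ∀ i, {x ∈ P | f i x + c i = 0} = faceSet f c {i} := fun i => by
    ext x
    simp [hP, faceSet]
  have hdimP : setDim P = Module.finrank ℝ E := setDim_of_interior_nonempty ⟨p, hp⟩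
  have hP0 : P = faceSet f c ∅ := by
    ext x
    simp [hP, faceSet]
  have hfacet : ∀ i, IsFacet P (faceSet f c {i}) := by
    intro i
    refine ⟨⟨⟨y i, hy i, fun j hj => (hyi i j).mpr (Finset.mem_singleton.mp hj)⟩, ?_⟩, ?_⟩
    · rw [hP0]
      exact isExposed_faceSet (Finset.empty_subset _)
    · rw [setDim, vectorSpan_faceSet (hy i) (hzero i), hdimP, ← finrank_ker_add_one (hf i),
        Finset.iInf_singleton]
  refine ⟨Equiv.ofBijective (fun i => ⟨faceSet f c {i}, hfacet i⟩) ⟨fun i k hik => ?_, ?_⟩,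
    fun j => (hface j).symm⟩
  · have h1 : faceSet f c {i} = faceSet f c {k} := congrArg Subtype.val hik
    have h2 : y i ∈ faceSet f c {k} := by
      rw [← h1]
      exact ⟨hy i, fun j hj => (hyi i j).mpr (Finset.mem_singleton.mp hj)⟩
    exact ((hyi i k).mp (h2.2 k (Finset.mem_singleton_self k))).symm
  · rintro ⟨G, hG, hdim⟩
    rw [hP0] at hG
    obtain ⟨τ, -, rfl, z, hz, hzτ⟩ := exists_eq_faceSet hG
    have hdim' := hdim
    rw [setDim, vectorSpan_faceSet hz hzτ, hdimP] at hdim'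
    obtain ⟨i, hi⟩ : τ.Nonempty := by
      rw [Finset.nonempty_iff_ne_empty]
      rintro rfl
      have h0 : (⨅ j ∈ (∅ : Finset V), LinearMap.ker (f j : E →ₗ[ℝ] ℝ)) = ⊤ := by simp
      rw [h0, finrank_top] at hdim'
      lia
    have hle : (⨅ j ∈ τ, LinearMap.ker (f j : E →ₗ[ℝ] ℝ)) ≤ LinearMap.ker (f i : E →ₗ[ℝ] ℝ) :=
      iInf₂_le i hi
    have heq := Submodule.eq_of_le_of_finrank_eq hle (by
      have := finrank_ker_add_one (hf i)
      lia)
    -- The common kernel of `τ` is the hyperplane `ker (f i)`, and this contains `y i - z`. Every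
    -- function of `τ` therefore vanishes at `y i`, where only the `i`-th one does.
    have hτ : τ = {i} := by
      refine Finset.eq_singleton_iff_unique_mem.mpr ⟨hi, fun j hj => ?_⟩
      have hz0 : ∀ k ∈ τ, f k z + c k = 0 := fun k hk => by
        rw [← hzτ, mem_zeroSet] at hk
        exact hk
      have h1 : y i - z ∈ LinearMap.ker (f i : E →ₗ[ℝ] ℝ) := by
        have h2 := (hyi i i).mpr rfl
        have h3 := hz0 i hi
        simp only [LinearMap.mem_ker, ContinuousLinearMap.coe_coe, map_sub]
        linarith
      rw [← heq, mem_iInf_ker] at h1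
      have h2 := h1 j hj
      rw [map_sub] at h2
      have h3 := hz0 j hj
      exact (hyi i j).mp (by linarith)
    subst hτ
    exact ⟨i, rfl⟩

/-- A presentation of a polytope by one inequality for each facet, such that the functionals of the
facets through a point are linearly independent. -/
structure IsSimplePresentation (P : Set E) (f : Facet P → E →L[ℝ] ℝ) (c : Facet P → ℝ) :
    Prop where
  eq_setOf : P = {x | ∀ j, 0 ≤ f j x + c j}
  facet_eq : ∀ j : Facet P, (j : Set E) = {x ∈ P | f j x + c j = 0}
  isCompact : IsCompact P
  nonempty : P.Nonempty
  exists_vector : ∀ x ∈ P, ∀ y : Facet P → ℝ, ∃ w, ∀ j, f j x + c j = 0 → f j w = y j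

/-- An irredundant system of half-spaces has one member for each facet. For independence at `x`,
pass to a vertex `v` of the smallest face containing `x`: the facets through `x` are among the `n`
facets through `v`. Since `v` is extreme, their functionals have no common kernel, so `n` of them
form a basis of the dual of `ℝⁿ`. -/
theorem IsSimplePolytope.exists_presentation {n : ℕ} {P : Set (EuclideanSpace ℝ (Fin n))}
    (hP : IsSimplePolytope P) :
    Finite (Facet P) ∧ ∃ f c, IsSimplePresentation P f c := by
  obtain ⟨m, a, b, hab⟩ := hP.halfspaces
  obtain ⟨I, hI, hirr⟩ := exists_irredundant (fun i => innerSL ℝ (a i)) b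
  have hPI : P = {x | ∀ i : I, 0 ≤ innerSL ℝ (a i) x + b i} := by
    have h1 : P = {x | ∀ i, 0 ≤ innerSL ℝ (a i) x + b i} := hab
    rw [h1, hI]
    ext x
    simp
  obtain ⟨e, he⟩ := bijective_facets_of_irredundant (f := fun i : I => innerSL ℝ (a i))
    (c := fun i : I => b i) hPI hP.full_dim fun i => by
      obtain ⟨x, hx, hx'⟩ := hirr i i.2
      exact ⟨x, hx, fun j hj => hx' j j.2 fun h => hj (Subtype.ext h)⟩
  have hfin : Finite (Facet P) := Finite.of_equiv _ e
  have := Fintype.ofFinite (Facet P)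
  set f : Facet P → EuclideanSpace ℝ (Fin n) →L[ℝ] ℝ := fun j => innerSL ℝ (a (e.symm j)) with hf
  set c : Facet P → ℝ := fun j => b (e.symm j) with hc
  have heq : P = {x | ∀ j, 0 ≤ f j x + c j} := by
    refine hPI.trans ?_
    ext x
    exact ⟨fun hx j => hx (e.symm j), fun hx i => by
      have := hx (e i)
      simpa only [hf, hc, e.symm_apply_apply] using this⟩
  have hfacet : ∀ j : Facet P, (j : Set _) = {x ∈ P | f j x + c j = 0} := fun j => by
    have := he (e.symm j)
    rwa [e.apply_symm_apply] at this
  have hcompact : IsCompact P := by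
    refine Metric.isCompact_of_isClosed_isBounded ?_ hP.bounded
    have : P = faceSet f c ∅ := by
      refine heq.trans ?_
      ext x
      simp [faceSet]
    rw [this]
    exact isClosed_faceSet f c ∅
  refine ⟨hfin, f, c, heq, hfacet, hcompact, hP.full_dim.mono interior_subset, fun x hx y => ?_⟩
  have hxP : ∀ j, 0 ≤ f j x + c j := by
    rwa [heq] at hx
  have hsub : faceSet f c (zeroSet f c x) ⊆ P := by
    intro z hz
    rw [heq]
    exact hz.1
  obtain ⟨v, hv⟩ := (hcompact.of_isClosed_subset (isClosed_faceSet f c (zeroSet f c x)) hsub)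
    |>.extremePoints_nonempty ⟨x, hxP, fun j hj => mem_zeroSet.mp hj⟩
  have hvx : zeroSet f c x ⊆ zeroSet f c v := fun j hj => mem_zeroSet.mpr (hv.1.2 j hj)
  have hvP := (isExtreme_faceSet heq _).extremePoints_subset_extremePoints hv
  have hcard : (zeroSet f c v).card = n := by
    have hval : Function.Injective fun j : Facet P => (j : Set (EuclideanSpace ℝ (Fin n))) :=
      Subtype.val_injective
    have h1 := hP.simple v hvP
    have h2 : {G : Set (EuclideanSpace ℝ (Fin n)) | IsFacet P G ∧ v ∈ G} =
        (fun j : Facet P => (j : Set (EuclideanSpace ℝ (Fin n)))) '' (zeroSet f c v : Set (Facet P)) := by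
      ext G
      constructor
      · rintro ⟨hG, hvG⟩
        refine ⟨⟨G, hG⟩, ?_, rfl⟩
        have h3 := hfacet ⟨G, hG⟩
        change G = _ at h3
        rw [h3] at hvG
        exact mem_zeroSet.mpr hvG.2
      · rintro ⟨j, hj, rfl⟩
        refine ⟨j.2, ?_⟩
        change v ∈ (j : Set (EuclideanSpace ℝ (Fin n)))
        rw [hfacet j]
        exact ⟨hvP.1, mem_zeroSet.mp hj⟩
    rw [h2, hval.encard_image] at h1
    have h4 := h1.symm.trans (encard_coe_eq_coe_finsetCard (zeroSet f c v))
    symm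
    exact_mod_cast h4
  let T : EuclideanSpace ℝ (Fin n) →ₗ[ℝ] (zeroSet f c v → ℝ) :=
    LinearMap.pi fun j => (f j : EuclideanSpace ℝ (Fin n) →ₗ[ℝ] ℝ)
  have hT : Function.Injective T := by
    rw [← LinearMap.ker_eq_bot, Submodule.eq_bot_iff]
    intro w hw
    refine eq_zero_of_mem_extremePoints heq hvP fun j hj => ?_
    exact congrFun (LinearMap.mem_ker.mp hw) ⟨j, mem_zeroSet.mpr hj⟩
  have hTs : Function.Surjective T :=
    (LinearMap.injective_iff_surjective_of_finrank_eq_finrank 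
      (by rw [finrank_euclideanSpace_fin, Module.finrank_fintype_fun_eq_card, Fintype.card_coe,
        hcard])).mp hT
  obtain ⟨w, hw⟩ := hTs fun j => y j
  exact ⟨w, fun j hj => congrFun hw ⟨j, hvx (mem_zeroSet.mpr hj)⟩⟩

end Presentation

/-! ### Faces of simple polytopes and flag nerve complexes -/

section Faces

open Set Filter Topology

/-- The sets of inequalities which are sharp at a common solution. -/
def faceFamily {V E : Type} [NormedAddCommGroup E] [NormedSpace ℝ E] (f : V → E →L[ℝ] ℝ)
    (c : V → ℝ) : Set (Finset V) :=
  {σ | (faceSet f c σ).Nonempty}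

/-- In a flag complex, a nonempty set of pairwise joined vertices is a simplex. -/
theorem IsFlagComplex.mem_of_pairwise {V : Type} {K : PreAbstractSimplicialComplex V}
    (hK : IsFlagComplex K) {σ : Finset V} (hne : σ.Nonempty)
    (h : ∀ τ : Finset V, τ ⊆ σ → τ.Nonempty → τ.card ≤ 2 → τ ∈ K) : σ ∈ K := by
  by_contra hσ
  obtain ⟨J, hJσ, hJ⟩ := exists_minimal_le_of_wellFoundedLT
    (fun τ : Finset V => τ.Nonempty ∧ τ ∉ K) σ ⟨hne, hσ⟩
  have hcard : 2 < J.card := by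
    by_contra! hle
    exact hJ.prop.2 (h J hJσ hJ.prop.1 hle)
  -- A nonface minimal under inclusion is a minimal nonface with at least three elements, against
  -- flagness.
  refine hcard.ne' (hK J ⟨hcard.le, fun τ hτ hτJ => ⟨?_, fun hne => ?_⟩⟩)
  · rintro hτK rfl
    exact hJ.prop.2 hτK
  · by_contra hτK
    exact hne (le_antisymm hτJ (hJ.le_of_le ⟨hτ, hτK⟩ hτJ))

namespace IsSimplePresentation

variable {E : Type} [NormedAddCommGroup E] [NormedSpace ℝ E] {P : Set E}
  {f : Facet P → E →L[ℝ] ℝ} {c : Facet P → ℝ}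

theorem mem_iff (S : IsSimplePresentation P f c) {x : E} : x ∈ P ↔ ∀ j, 0 ≤ f j x + c j := by
  constructor
  · intro hx
    rw [S.eq_setOf] at hx
    exact hx
  · intro hx
    rw [S.eq_setOf]
    exact hx

theorem mem_facet_iff (S : IsSimplePresentation P f c) {x : E} {j : Facet P} :
    x ∈ (j : Set E) ↔ x ∈ P ∧ f j x + c j = 0 := by
  rw [S.facet_eq j]
  rfl

theorem mem_faceSet_iff (S : IsSimplePresentation P f c) {σ : Finset (Facet P)} {x : E} :
    x ∈ faceSet f c σ ↔ x ∈ P ∧ ∀ j ∈ σ, x ∈ (j : Set E) := by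
  rw [faceSet, mem_ofPred_eq, ← S.mem_iff]
  exact and_congr_right fun hx => forall₂_congr fun j _ => by simp [S.mem_facet_iff, hx]

theorem mem_nerveComplex_iff (S : IsSimplePresentation P f c) {σ : Finset (Facet P)} :
    σ ∈ nerveComplex P ↔ σ.Nonempty ∧ σ ∈ faceFamily f c := by
  refine and_congr_right fun ⟨j, hj⟩ => ⟨?_, ?_⟩
  · rintro ⟨x, hx⟩
    simp only [mem_iInter] at hx
    exact ⟨x, S.mem_faceSet_iff.mpr ⟨j.subset (hx j hj), hx⟩⟩
  · rintro ⟨x, hx⟩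
    refine ⟨x, ?_⟩
    simp only [mem_iInter]
    exact (S.mem_faceSet_iff.mp hx).2

theorem faceSet_empty (S : IsSimplePresentation P f c) : faceSet f c ∅ = P := by
  ext x
  simp [S.mem_faceSet_iff]

theorem empty_mem (S : IsSimplePresentation P f c) : ∅ ∈ faceFamily f c := by
  rw [faceFamily, mem_ofPred_eq, S.faceSet_empty]
  exact S.nonempty

variable [Fintype (Facet P)]

/-- Every set of facets with a common point has a common point which lies in no other facet. -/
theorem exists_zeroSet_eq (S : IsSimplePresentation P f c) {σ : Finset (Facet P)}
    (hσ : σ ∈ faceFamily f c) : ∃ z, (∀ j, 0 ≤ f j z + c j) ∧ zeroSet f c z = σ := by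
  classical
  obtain ⟨x, hx, hxσ⟩ := hσ
  -- Independence at `x` gives a direction that stays on the facets of `σ` and leaves all the other
  -- facets through `x`.
  obtain ⟨w, hw⟩ := S.exists_vector x (S.mem_iff.mpr hx) fun j => if j ∈ σ then 0 else 1
  obtain ⟨r, hr, h1, h2⟩ := exists_move hx w fun j hj => by
    rw [hw j hj]
    split_ifs <;> simp
  refine ⟨x + r • w, h1, ?_⟩
  ext j
  rw [mem_zeroSet]
  constructor
  · intro h
    by_contra hj
    rcases (hx j).eq_or_lt with h0 | h0
    · rw [affine_add_smul, ← h0, hw j h0.symm, if_neg hj] at h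
      linarith
    · exact (h2 j h0).ne' h
  · intro hj
    rw [affine_add_smul, hxσ j hj, hw j (hxσ j hj), if_pos hj]
    simp

/-- Test the inclusion at a point that lies on the facets of `σ` only. It follows that a nonempty
face determines its set of facets. -/
theorem subset_of_faceSet_subset (S : IsSimplePresentation P f c) {σ τ : Finset (Facet P)}
    (hσ : σ ∈ faceFamily f c) (h : faceSet f c σ ⊆ faceSet f c τ) : τ ⊆ σ := by
  obtain ⟨z, hz, hzσ⟩ := S.exists_zeroSet_eq hσ
  intro j hj
  rw [← hzσ, mem_zeroSet]
  refine (h ⟨hz, fun i hi => ?_⟩).2 j hj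
  rwa [← hzσ, mem_zeroSet] at hi

/-- The direction of the face is the common kernel of `|σ|` independent functionals. -/
theorem setDim_faceSet_add_card [FiniteDimensional ℝ E] (S : IsSimplePresentation P f c)
    {σ : Finset (Facet P)} (hσ : σ ∈ faceFamily f c) :
    setDim (faceSet f c σ) + σ.card = Module.finrank ℝ E := by
  obtain ⟨z, hz, hzσ⟩ := S.exists_zeroSet_eq hσ
  let T : E →ₗ[ℝ] (σ → ℝ) := LinearMap.pi fun j => (f j : E →ₗ[ℝ] ℝ)
  have hker : LinearMap.ker T = ⨅ j ∈ σ, LinearMap.ker (f j : E →ₗ[ℝ] ℝ) := by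
    ext w
    rw [mem_iInf_ker, LinearMap.mem_ker]
    exact ⟨fun h j hj => congrFun h ⟨j, hj⟩, fun h => funext fun j => h j j.2⟩
  have hT : Function.Surjective T := by
    classical
    intro y
    obtain ⟨w, hw⟩ := S.exists_vector z (S.mem_iff.mpr hz)
      fun j => if h : j ∈ σ then y ⟨j, h⟩ else 0
    refine ⟨w, funext fun j => ?_⟩
    have hj : f j z + c j = 0 := by
      rw [← mem_zeroSet, hzσ]
      exact j.2
    exact (hw j hj).trans (by simp)
  have := T.finrank_range_add_finrank_ker
  rw [LinearMap.range_eq_top.mpr hT, finrank_top, Module.finrank_fintype_fun_eq_card,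
    Fintype.card_coe, hker] at this
  rw [setDim, vectorSpan_faceSet hz hzσ, add_comm]
  exact this

theorem exists_eq_faceSet (S : IsSimplePresentation P f c) {F : Set E} (hF : IsFace P F) :
    ∃ σ ∈ faceFamily f c, F = faceSet f c σ := by
  have hne := hF.1
  rw [← S.faceSet_empty] at hF
  obtain ⟨σ, -, rfl, -⟩ := _root_.exists_eq_faceSet hF
  exact ⟨σ, hne, rfl⟩

variable [FiniteDimensional ℝ E]

-- Faces of the face `σ` are the faces of larger sets `τ`, and by the dimension formula codimension
-- one means that `τ` has exactly one more element.
open Classical in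
theorem isFacet_faceSet_iff (S : IsSimplePresentation P f c) {σ : Finset (Facet P)}
    (hσ : σ ∈ faceFamily f c) {G : Set E} :
    IsFacet (faceSet f c σ) G ↔
      ∃ j ∉ σ, insert j σ ∈ faceFamily f c ∧ G = faceSet f c (insert j σ) := by
  have hd := S.setDim_faceSet_add_card hσ
  constructor
  · rintro ⟨hG, hdim⟩
    have hne := hG.1
    obtain ⟨τ, hστ, rfl, -⟩ := _root_.exists_eq_faceSet hG
    have hd' := S.setDim_faceSet_add_card hne
    obtain ⟨j, hj⟩ : ∃ j, τ \ σ = {j} := by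
      rw [← Finset.card_eq_one, Finset.card_sdiff_of_subset hστ]
      lia
    have hτ : τ = insert j σ := by
      rw [Finset.insert_eq, ← hj, Finset.sdiff_union_of_subset hστ]
    refine ⟨j, ?_, hτ ▸ hne, by rw [hτ]⟩
    have : j ∈ τ \ σ := by simp [hj]
    exact (Finset.mem_sdiff.mp this).2
  · rintro ⟨j, hj, hne, rfl⟩
    refine ⟨⟨hne, isExposed_faceSet (Finset.subset_insert j σ)⟩, ?_⟩
    have hd' := S.setDim_faceSet_add_card hne
    rw [Finset.card_insert_of_notMem hj] at hd'
    lia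

omit [Fintype (Facet P)] [FiniteDimensional ℝ E] in
open Classical in
theorem faceSet_insert (S : IsSimplePresentation P f c) (σ : Finset (Facet P)) (j : Facet P) :
    faceSet f c (insert j σ) = faceSet f c σ ∩ (j : Set E) := by
  ext x
  simp only [mem_inter_iff, S.mem_faceSet_iff, Finset.forall_mem_insert]
  tauto

open Classical in
/-- Every facet of a face of a simple polytope is cut out by a unique facet of the polytope. -/
theorem exists_facetMap (S : IsSimplePresentation P f c) {σ : Finset (Facet P)}
    (hσ : σ ∈ faceFamily f c) :
    ∃ φ : Facet (faceSet f c σ) → Facet P, IsFacetMap P (faceSet f c σ) φ ∧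
      (∀ ψ, IsFacetMap P (faceSet f c σ) ψ → ψ = φ) ∧
      ∀ j, j ∈ range φ ↔ j ∉ σ ∧ insert j σ ∈ faceFamily f c := by
  have h := fun G : Facet (faceSet f c σ) => (S.isFacet_faceSet_iff hσ).mp G.2
  choose φ hφσ hφne hφ using h
  have hmap : IsFacetMap P (faceSet f c σ) φ := fun G => (hφ G).trans (S.faceSet_insert σ (φ G))
  refine ⟨φ, hmap, fun ψ hψ => funext fun G => ?_, fun j => ⟨?_, ?_⟩⟩
  · have h1 : (G : Set E) = faceSet f c (insert (ψ G) σ) := (hψ G).trans (S.faceSet_insert σ _).symm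
    have h2 : (G : Set E) = faceSet f c (insert (φ G) σ) := hφ G
    have h3 := S.subset_of_faceSet_subset (hφne G) (h2.symm.trans h1).subset
    have h4 := S.subset_of_faceSet_subset (τ := insert (φ G) σ) (σ := insert (ψ G) σ)
      (show (faceSet f c (insert (ψ G) σ)).Nonempty from h1 ▸ G.2.1.1) (h1.symm.trans h2).subset
    have h5 := h4 (Finset.mem_insert_self _ _)
    exact ((Finset.mem_insert.mp h5).resolve_right (hφσ G)).symm
  · rintro ⟨G, rfl⟩
    exact ⟨hφσ G, hφne G⟩
  · rintro ⟨hj, hne⟩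
    let G : Facet (faceSet f c σ) :=
      ⟨faceSet f c (insert j σ), (S.isFacet_faceSet_iff hσ).mpr ⟨j, hj, hne, rfl⟩⟩
    refine ⟨G, ?_⟩
    have h2 : faceSet f c (insert j σ) = faceSet f c (insert (φ G) σ) := hφ G
    have h5 := S.subset_of_faceSet_subset hne h2.subset (Finset.mem_insert_self _ _)
    exact (Finset.mem_insert.mp h5).resolve_right (hφσ G)

omit [Fintype (Facet P)] [FiniteDimensional ℝ E] in
open Classical in
/-- In a flag simple polytope, a simplex of the nerve whose vertices are adjacent to the simplex `σ`
spans a simplex with `σ`. -/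
theorem union_mem_of_flag (S : IsSimplePresentation P f c) (hflag : IsFlagComplex (nerveComplex P))
    {σ τ : Finset (Facet P)} (hσ : σ ∈ faceFamily f c) (hτ : τ ∈ faceFamily f c)
    (h : ∀ j ∈ τ, insert j σ ∈ faceFamily f c) : τ ∪ σ ∈ faceFamily f c := by
  rcases (τ ∪ σ).eq_empty_or_nonempty with h0 | hne
  · rw [h0]
    exact S.empty_mem
  refine (S.mem_nerveComplex_iff.mp (hflag.mem_of_pairwise hne fun ρ hρ hρne hcard => ?_)).2
  refine S.mem_nerveComplex_iff.mpr ⟨hρne, ?_⟩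
  have hdown : ∀ {α β : Finset (Facet P)}, α ⊆ β → β ∈ faceFamily f c → α ∈ faceFamily f c :=
    fun hαβ hβ => hβ.mono (faceSet_anti hαβ)
  by_cases hρσ : ρ ⊆ σ
  · exact hdown hρσ hσ
  by_cases hρτ : ρ ⊆ τ
  · exact hdown hρτ hτ
  obtain ⟨i, hi, hiσ⟩ := Finset.not_subset.mp hρσ
  have hiτ : i ∈ τ := (Finset.mem_union.mp (hρ hi)).resolve_right hiσ
  -- It remains to see that `ρ ⊆ insert i σ`. An element `k` violating this, the element `i ∈ τ \ σ`
  -- and some `l ∈ ρ \ τ` would be three different elements of `ρ`.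
  refine hdown (fun k hk => ?_) (h i hiτ)
  rw [Finset.mem_insert]
  by_contra! hk'
  have hkτ : k ∈ τ := (Finset.mem_union.mp (hρ hk)).resolve_right hk'.2
  obtain ⟨l, hl, hlτ⟩ := Finset.not_subset.mp hρτ
  have : ({i, k, l} : Finset (Facet P)).card ≤ ρ.card := by
    refine Finset.card_le_card fun x hx => ?_
    simp only [Finset.mem_insert, Finset.mem_singleton] at hx
    rcases hx with rfl | rfl | rfl <;> assumption
  rw [Finset.card_eq_three.mpr ⟨i, k, l, hk'.1.symm, fun h => hlτ (h ▸ hiτ),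
    fun h => hlτ (h ▸ hkτ), rfl⟩] at this
  lia

-- A simplex `τ` on vertices in the range of `φ` spans a simplex with `σ`, and a common point of the
-- facets in `τ ∪ σ` is a point of the face on all the facets of the face cut out by `τ`.
omit [Fintype (Facet P)] [FiniteDimensional ℝ E] in
open Classical in
theorem imageComplex_eq (S : IsSimplePresentation P f c) {σ : Finset (Facet P)}
    {φ : Facet (faceSet f c σ) → Facet P} (hφ : IsFacetMap P (faceSet f c σ) φ)
    (hlink : ∀ τ ∈ faceFamily f c, (τ : Set (Facet P)) ⊆ range φ → τ ∪ σ ∈ faceFamily f c) :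
    imageComplex φ (nerveComplex (faceSet f c σ)) =
      fullSubcomplex (nerveComplex P) (range φ) := by
  apply le_antisymm
  · intro τ hτ
    refine ⟨hφ.isSimplicialEmbedding.simplicial hτ, ?_⟩
    obtain ⟨ρ, -, rfl⟩ := hτ
    intro j hj
    simp only [Finset.coe_image, Set.mem_image] at hj
    obtain ⟨G, -, rfl⟩ := hj
    exact mem_range_self G
  · rintro τ ⟨hτ, hrange⟩
    obtain ⟨hne, hτ⟩ := S.mem_nerveComplex_iff.mp hτ
    obtain ⟨x, hx⟩ := hlink τ hτ hrange
    obtain ⟨ρ, -, rfl⟩ := Finset.subset_set_image_iff.mp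
      (show (τ : Set (Facet P)) ⊆ φ '' univ by rwa [image_univ])
    refine ⟨ρ, ⟨by simpa using hne, x, ?_⟩, ?_⟩
    · simp only [mem_iInter]
      intro G hG
      rw [hφ G]
      refine ⟨faceSet_anti Finset.subset_union_right hx, ?_⟩
      exact (S.mem_faceSet_iff.mp hx).2 _
        (Finset.mem_union_left _ (Finset.mem_image_of_mem φ hG))
    · ext
      simp

end IsSimplePresentation

end Faces

/-! ### Slices parallel to a face -/

section Slices

open Set Filter Topology

variable {V E : Type} [NormedAddCommGroup E] [NormedSpace ℝ E]

open Classical in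
/-- The simplices of the link of `σ` in the family `K`. -/
def linkFamily (K : Set (Finset V)) (σ : Finset V) : Set (Finset V) :=
  {τ | Disjoint τ σ ∧ τ ∪ σ ∈ K}

/-- The points of `P` at which the functions with index in `σ` take given values. -/
def slice (P : Set E) (f : V → E →L[ℝ] ℝ) (c : V → ℝ) (σ : Finset V) (s : σ → ℝ) : Set E :=
  {x ∈ P | ∀ i : σ, f i x + c i = s i}

open Classical in
/-- The linear part of the inequalities on a slice: those with index in `σ` are made void. -/
def offLinear (f : V → E →L[ℝ] ℝ) (σ : Finset V) (j : V) : E →L[ℝ] ℝ :=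
  if j ∈ σ then 0 else f j

open Classical in
/-- The constant part of the inequalities on a slice: those with index in `σ` are made void. -/
def offConst (c : V → ℝ) (σ : Finset V) (j : V) : ℝ :=
  if j ∈ σ then 1 else c j

theorem off_of_mem {f : V → E →L[ℝ] ℝ} {c : V → ℝ} {σ : Finset V} {j : V} (hj : j ∈ σ) (x : E) :
    offLinear f σ j x + offConst c σ j = 1 := by
  simp [offLinear, offConst, hj]

theorem off_of_notMem {f : V → E →L[ℝ] ℝ} {c : V → ℝ} {σ : Finset V} {j : V} (hj : j ∉ σ) (x : E) :
    offLinear f σ j x + offConst c σ j = f j x + c j := by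
  simp [offLinear, offConst, hj]

namespace IsSimplePresentation

variable {P : Set E} {f : Facet P → E →L[ℝ] ℝ} {c : Facet P → ℝ}

theorem faceFamily_of_subset {σ τ : Finset (Facet P)} (h : τ ⊆ σ) (hσ : σ ∈ faceFamily f c) :
    τ ∈ faceFamily f c :=
  Set.Nonempty.mono (faceSet_anti h) hσ

theorem isCompact_faceSet (S : IsSimplePresentation P f c) (σ : Finset (Facet P)) :
    IsCompact (faceSet f c σ) :=
  S.isCompact.of_isClosed_subset (isClosed_faceSet f c σ) fun _ hx => S.mem_iff.mpr hx.1

variable [Fintype (Facet P)]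

-- A point close enough to all facets of `σ` lies only on facets that meet the face `σ` jointly. For
-- each `τ`, the sum of the functions of `σ` has a minimum on the compact face `τ`: if it is zero,
-- `τ ∪ σ` has a common point; otherwise `|σ| * ε` is taken below it. There are finitely many `τ`.
open Classical in
theorem exists_pos_union_mem (S : IsSimplePresentation P f c) (σ : Finset (Facet P)) :
    ∃ ε > 0, ∀ x ∈ P, (∀ i ∈ σ, f i x + c i ≤ ε) → zeroSet f c x ∪ σ ∈ faceFamily f c := by
  have h : ∀ τ : Finset (Facet P), ∀ᶠ ε in 𝓝[>] (0 : ℝ), ∀ x ∈ faceSet f c τ,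
      (∀ i ∈ σ, f i x + c i ≤ ε) → τ ∪ σ ∈ faceFamily f c := by
    intro τ
    rcases (faceSet f c τ).eq_empty_or_nonempty with h0 | hne
    · simp [h0]
    have hc : Continuous fun x => ∑ i ∈ σ, (f i x + c i) := by fun_prop
    obtain ⟨x₀, hx₀, hmin⟩ := (S.isCompact_faceSet τ).exists_isMinOn hne hc.continuousOn
    have hnn : 0 ≤ ∑ i ∈ σ, (f i x₀ + c i) := Finset.sum_nonneg fun i _ => hx₀.1 i
    rcases hnn.eq_or_lt with h0 | hpos
    · have h1 := (Finset.sum_eq_zero_iff_of_nonneg fun i _ => hx₀.1 i).mp h0.symm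
      have h2 : τ ∪ σ ∈ faceFamily f c := by
        refine ⟨x₀, hx₀.1, fun j hj => ?_⟩
        rcases Finset.mem_union.mp hj with hj | hj
        · exact hx₀.2 j hj
        · exact h1 j hj
      exact Eventually.of_forall fun _ _ _ _ => h2
    · have hlim : ∀ᶠ ε in 𝓝 (0 : ℝ), σ.card * ε < ∑ i ∈ σ, (f i x₀ + c i) := by
        have : Continuous fun ε : ℝ => σ.card * ε := by fun_prop
        exact this.continuousAt.eventually (gt_mem_nhds (by simpa using hpos))
      filter_upwards [hlim.filter_mono nhdsWithin_le_nhds] with ε hε x hx hxε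
      have h1 := hmin hx
      have h2 := Finset.sum_le_card_nsmul σ _ ε hxε
      rw [nsmul_eq_mul] at h2
      simp only [mem_ofPred_eq] at h1
      linarith
  obtain ⟨ε, hε0, hε⟩ := ((eventually_mem_nhdsWithin (a := (0 : ℝ)) (s := Ioi 0)).and
    (eventually_all.mpr h)).exists
  refine ⟨ε, hε0, fun x hx hxε => hε (zeroSet f c x) x ⟨S.mem_iff.mp hx, fun j hj => ?_⟩ hxε⟩
  exact mem_zeroSet.mp hj

open Classical in
/-- The slices parallel and close to a face carry barycentric systems for the link of the face, which
depend continuously on the slice. -/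
theorem exists_slices (S : IsSimplePresentation P f c) (σ : Finset (Facet P)) :
    ∃ ε > 0, ∃ β : (σ → ℝ) → Finset (Facet P) → E, Continuous β ∧
      ∀ s : σ → ℝ, (∀ i, 0 ≤ s i) → (∀ i, s i ≤ ε) →
        IsBarycentricSystem (slice P f c σ s) (offLinear f σ) (offConst c σ)
          (linkFamily (faceFamily f c) σ) (β s) := by
  have hb : ∀ τ : Finset (Facet P), ∃ b : E, τ ∪ σ ∈ faceFamily f c →
      (∀ j, 0 ≤ f j b + c j) ∧ zeroSet f c b = τ ∪ σ := fun τ => by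
    by_cases h : τ ∪ σ ∈ faceFamily f c
    · obtain ⟨z, hz⟩ := S.exists_zeroSet_eq h
      exact ⟨z, fun _ => hz⟩
    · exact ⟨0, fun h' => absurd h' h⟩
  choose b hb using hb
  -- Dual vectors: `w τ i` leaves the facet `i` of `σ` at unit speed and stays parallel to the other
  -- facets in `τ ∪ σ`. Adding `∑ i, s i • w τ i` to a generic point of the face `τ ∪ σ` thus lands
  -- on the slice `s`, still on the facets of `τ \ σ`.
  have hw : ∀ (τ : Finset (Facet P)) (i : σ), ∃ w : E, τ ∪ σ ∈ faceFamily f c →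
      ∀ j ∈ τ ∪ σ, f j w = if j = i then 1 else 0 := fun τ i => by
    by_cases h : τ ∪ σ ∈ faceFamily f c
    · obtain ⟨hb1, hb2⟩ := hb τ h
      obtain ⟨w, hw⟩ := S.exists_vector (b τ) (S.mem_iff.mpr hb1) fun j => if j = i then 1 else 0
      refine ⟨w, fun _ j hj => hw j ?_⟩
      rwa [← mem_zeroSet, hb2]
    · exact ⟨0, fun h' => absurd h' h⟩
  choose w hw using hw
  let β : (σ → ℝ) → Finset (Facet P) → E := fun s τ => b τ + ∑ i, s i • w τ i
  have hβ : Continuous β := by fun_prop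
  have hval : ∀ s τ j, f j (β s τ) + c j = f j (b τ) + c j + ∑ i, s i * f j (w τ i) := by
    intro s τ j
    simp only [β, map_add, map_sum, map_smul, smul_eq_mul]
    ring
  have hβσ : ∀ s τ, τ ∪ σ ∈ faceFamily f c → ∀ i : σ, f i (β s τ) + c i = s i := by
    intro s τ hτ i
    have hi : (i : Facet P) ∈ τ ∪ σ := Finset.mem_union_right _ i.2
    have h0 : f i (b τ) + c i = 0 := by
      rw [← mem_zeroSet, (hb τ hτ).2]
      exact hi
    rw [hval, h0, zero_add, Finset.sum_eq_single i]
    · rw [hw τ i hτ _ hi]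
      simp
    · intro k _ hk
      rw [hw τ k hτ _ hi, if_neg fun h => hk (Subtype.ext h.symm), mul_zero]
    · simp
  have hβτ : ∀ s τ, τ ∈ linkFamily (faceFamily f c) σ → ∀ j ∈ τ, f j (β s τ) + c j = 0 := by
    intro s τ hτ j hj
    have hj' : j ∈ τ ∪ σ := Finset.mem_union_left _ hj
    have h0 : f j (b τ) + c j = 0 := by
      rw [← mem_zeroSet, (hb τ hτ.2).2]
      exact hj'
    rw [hval, h0, zero_add]
    refine Finset.sum_eq_zero fun k _ => ?_
    rw [hw τ k hτ.2 _ hj', if_neg, mul_zero]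
    rintro rfl
    exact Finset.disjoint_left.mp hτ.1 hj k.2
  have hpos : ∀ᶠ s in 𝓝 (0 : σ → ℝ), ∀ τ j, τ ∪ σ ∈ faceFamily f c → j ∉ τ ∪ σ →
      0 < f j (β s τ) + c j := by
    refine eventually_all.mpr fun τ => eventually_all.mpr fun j => ?_
    by_cases h : τ ∪ σ ∈ faceFamily f c ∧ j ∉ τ ∪ σ
    · have h0 : 0 < f j (β 0 τ) + c j := by
        rw [hval]
        simp only [Pi.zero_apply, zero_mul, Finset.sum_const_zero, add_zero]
        refine ((hb τ h.1).1 j).lt_of_ne fun h' => h.2 ?_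
        rw [← (hb τ h.1).2, mem_zeroSet]
        exact h'.symm
      have hcont : Continuous fun s => f j (β s τ) + c j := by fun_prop
      exact (hcont.continuousAt.eventually (lt_mem_nhds h0)).mono fun s hs _ _ => hs
    · exact Eventually.of_forall fun s h1 h2 => absurd ⟨h1, h2⟩ h
  obtain ⟨ε₁, hε₁, hball⟩ := Metric.eventually_nhds_iff.mp hpos
  obtain ⟨ε₂, hε₂, hunion⟩ := S.exists_pos_union_mem σ
  -- The bound `ε₁` keeps the functions outside `τ ∪ σ` positive at `β s τ`, and halving it makes
  -- the distance to `0` strictly smaller; `ε₂` makes the zero sets of points of the slice belong to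
  -- the link.
  refine ⟨min (ε₁ / 2) ε₂, by positivity, β, hβ, fun s hs0 hs => ?_⟩
  have hs1 : dist s 0 < ε₁ := by
    rw [dist_pi_lt_iff hε₁]
    intro i
    rw [Pi.zero_apply, Real.dist_eq, sub_zero, abs_of_nonneg (hs0 i)]
    have := (hs i).trans (min_le_left _ _)
    linarith
  have hs2 : ∀ i, s i ≤ ε₂ := fun i => (hs i).trans (min_le_right _ _)
  have hzero : ∀ τ ∈ linkFamily (faceFamily f c) σ, ∀ j ∉ σ, (f j (β s τ) + c j = 0 ↔ j ∈ τ) := by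
    intro τ hτ j hj
    refine ⟨fun h => ?_, hβτ s τ hτ j⟩
    by_contra hjτ
    exact (hball hs1 τ j hτ.2 (by simp [hj, hjτ])).ne' h
  refine ⟨?_, ?_, ?_, ?_, ?_, ?_, ?_⟩
  · refine S.isCompact.of_isClosed_subset ?_ fun x hx => hx.1
    have : slice P f c σ s = P ∩ ⋂ i : σ, {x | f i x + c i = s i} := by
      ext x
      simp [slice]
    rw [this]
    exact S.isCompact.isClosed.inter
      (isClosed_iInter fun i => isClosed_eq (by fun_prop) continuous_const)
  · intro x hx j
    by_cases hj : j ∈ σ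
    · rw [off_of_mem hj]
      exact zero_le_one
    · rw [off_of_notMem hj]
      exact S.mem_iff.mp hx.1 j
  · intro x hx y hy r hr
    have h1 : ∀ i : σ, f i (x + r • (y - x)) + c i = s i := fun i => by
      rw [affine_line, hx.2 i, hy.2 i]
      ring
    refine ⟨S.mem_iff.mpr fun j => ?_, h1⟩
    by_cases hj : j ∈ σ
    · exact (hs0 ⟨j, hj⟩).trans_eq (h1 ⟨j, hj⟩).symm
    · have := hr j
      rwa [off_of_notMem hj] at this
  · intro x hx
    have h1 := hunion x hx.1 fun i hi => (hx.2 ⟨i, hi⟩).trans_le (hs2 _)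
    refine ⟨Finset.disjoint_left.mpr fun j hj hjσ => ?_, faceFamily_of_subset (fun j hj => ?_) h1⟩
    · rw [mem_zeroSet, off_of_mem hjσ] at hj
      exact one_ne_zero hj
    · rw [Finset.mem_union] at hj ⊢
      by_cases hjσ : j ∈ σ
      · exact Or.inr hjσ
      · have := hj.resolve_right hjσ
        rw [mem_zeroSet, off_of_notMem hjσ] at this
        exact Or.inl (mem_zeroSet.mpr this)
  · intro τ hτ ρ hρ
    exact ⟨hτ.1.mono_left hρ, faceFamily_of_subset (Finset.union_subset_union_left hρ) hτ.2⟩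
  · intro τ hτ
    refine ⟨S.mem_iff.mpr fun j => ?_, hβσ s τ hτ.2⟩
    by_cases hj : j ∈ σ
    · exact (hs0 ⟨j, hj⟩).trans_eq (hβσ s τ hτ.2 ⟨j, hj⟩).symm
    · by_cases hjτ : j ∈ τ
      · exact (hβτ s τ hτ j hjτ).ge
      · exact (hball hs1 τ j hτ.2 (by simp [hj, hjτ])).le
  · intro τ hτ j
    by_cases hj : j ∈ σ
    · rw [off_of_mem hj]
      simp [Finset.disjoint_right.mp hτ.1 hj]
    · rw [off_of_notMem hj]
      exact hzero τ hτ j hj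

omit [Fintype (Facet P)] in
open Classical in
theorem linkFamily_subset {σ : Finset (Facet P)} :
    linkFamily (faceFamily f c) σ ⊆ faceFamily f c :=
  fun _ hτ => faceFamily_of_subset Finset.subset_union_left hτ.2

/-- A barycentric system on a slice in the interior of the neighbourhood of a face extends to the
polytope. -/
theorem exists_extension (S : IsSimplePresentation P f c) {σ : Finset (Facet P)} {s : σ → ℝ}
    (hs : ∀ i, 0 < s i) {b₀ : Finset (Facet P) → E}
    (h : IsBarycentricSystem (slice P f c σ s) (offLinear f σ) (offConst c σ)
      (linkFamily (faceFamily f c) σ) b₀) :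
    ∃ b, IsBarycentricSystem P f c (faceFamily f c) b ∧
      ∀ τ ∈ linkFamily (faceFamily f c) σ, b τ = b₀ τ := by
  classical
  have hb : ∀ τ : Finset (Facet P), ∃ b : E,
      (τ ∈ faceFamily f c → b ∈ P ∧ ∀ j, f j b + c j = 0 ↔ j ∈ τ) ∧
      (τ ∈ linkFamily (faceFamily f c) σ → b = b₀ τ) := by
    intro τ
    by_cases hτ : τ ∈ linkFamily (faceFamily f c) σ
    · have hmem := h.mem τ hτ
      refine ⟨b₀ τ, fun _ => ⟨hmem.1, fun j => ?_⟩, fun _ => rfl⟩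
      -- On this slice the functions of `σ` take the positive values `s`, so in `P` the point `b₀ τ`
      -- has zero set exactly `τ`.
      by_cases hj : j ∈ σ
      · refine iff_of_false ?_ (Finset.disjoint_right.mp hτ.1 hj)
        rw [hmem.2 ⟨j, hj⟩]
        exact (hs _).ne'
      · rw [← h.eq_zero_iff τ hτ j, off_of_notMem hj]
    · by_cases hτ' : τ ∈ faceFamily f c
      · obtain ⟨z, hz, hzτ⟩ := S.exists_zeroSet_eq hτ'
        refine ⟨z, fun _ => ⟨S.mem_iff.mpr hz, fun j => ?_⟩, fun h => absurd h hτ⟩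
        rw [← hzτ, mem_zeroSet]
      · exact ⟨0, fun h => absurd h hτ', fun h => absurd h hτ⟩
  choose b hb hb₀ using hb
  refine ⟨b, ⟨S.isCompact, fun x hx => S.mem_iff.mp hx, fun x _ y _ r hr => S.mem_iff.mpr hr,
    fun x hx => ⟨x, S.mem_iff.mp hx, fun j hj => mem_zeroSet.mp hj⟩,
    fun σ hσ τ hτ => faceFamily_of_subset hτ hσ, fun τ hτ => (hb τ hτ).1,
    fun τ hτ => (hb τ hτ).2⟩, hb₀⟩

end IsSimplePresentation

end Slices

/-! ### Models of moment-angle manifolds -/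

section Models

open Set Filter Topology

variable {E : Type} [NormedAddCommGroup E] [NormedSpace ℝ E]

namespace MomentAngleManifold

/-- The class of `(t, p)` in the moment-angle manifold. -/
def mk {C : Set E} (t : Facet C → Circle) (p : C) : MomentAngleManifold C :=
  Quotient.mk (momentAngleSetoid C) (t, p)

variable {C : Set E}

theorem mk_eq_mk_iff {t s : Facet C → Circle} {p q : C} :
    mk t p = mk s q ↔ p = q ∧ ∀ G : Facet C, (p : E) ∉ (G : Set E) → t G = s G := by
  refine Quotient.eq.trans (and_congr_right fun _ => forall₂_congr fun G _ => ?_)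
  simp [mul_inv_eq_one]

theorem exists_mk (x : MomentAngleManifold C) : ∃ t p, mk t p = x := by
  induction x using Quotient.inductionOn with
  | h x => exact ⟨x.1, x.2, rfl⟩

theorem compactSpace (hC : IsCompact C) : CompactSpace (MomentAngleManifold C) := by
  have : CompactSpace C := isCompact_iff_compactSpace.mp hC
  exact inferInstanceAs (CompactSpace (Quotient (momentAngleSetoid C)))

/-- A continuous surjection from `T^{𝓕(C)} × C` with the right fibres defines a homeomorphism. -/
theorem exists_homeomorph (hC : IsCompact C) {X : Type} [TopologicalSpace X] [T2Space X]
    (g : (Facet C → Circle) × C → X) (hg : Continuous g) (hsurj : Function.Surjective g)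
    (hiff : ∀ t p s q, g (t, p) = g (s, q) ↔
      p = q ∧ ∀ G : Facet C, (p : E) ∉ (G : Set E) → t G = s G) :
    ∃ H : MomentAngleManifold C ≃ₜ X, ∀ t p, H (mk t p) = g (t, p) := by
  have := compactSpace hC
  let H : MomentAngleManifold C → X :=
    Quotient.lift g fun x y hxy => (hiff x.1 x.2 y.1 y.2).mpr (mk_eq_mk_iff.mp (Quotient.sound hxy))
  have hH : Continuous H := hg.quotient_lift _
  have hbij : Function.Bijective H := by
    constructor
    · intro x y hxy
      obtain ⟨t, p, rfl⟩ := exists_mk x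
      obtain ⟨s, q, rfl⟩ := exists_mk y
      exact mk_eq_mk_iff.mpr ((hiff t p s q).mp hxy)
    · intro z
      obtain ⟨x, rfl⟩ := hsurj z
      exact ⟨mk x.1 x.2, rfl⟩
  exact ⟨Continuous.homeoOfEquivCompactToT2 (f := Equiv.ofBijective H hbij) hH, fun _ _ => rfl⟩

end MomentAngleManifold

theorem exists_circle_mul_norm (z : ℂ) : ∃ t : Circle, (t : ℂ) * (‖z‖ : ℂ) = z := by
  by_cases hz : z = 0
  · exact ⟨1, by simp [hz]⟩
  · refine ⟨Circle.exp z.arg, ?_⟩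
    simpa [mul_comm] using Complex.norm_mul_exp_arg_mul_I z

theorem circle_mul_eq_iff {t s : Circle} {r q : ℝ} (hr : 0 ≤ r) (hq : 0 ≤ q) :
    (t : ℂ) * r = s * q ↔ r = q ∧ (r ≠ 0 → t = s) := by
  constructor
  · intro h
    have h1 := congrArg norm h
    simp only [norm_mul, Circle.norm_coe, one_mul, Complex.norm_real, Real.norm_eq_abs,
      abs_of_nonneg hr, abs_of_nonneg hq] at h1
    refine ⟨h1, fun h0 => ?_⟩
    rw [← h1] at h
    exact Circle.ext (mul_right_cancel₀ (Complex.ofReal_ne_zero.mpr h0) h)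
  · rintro ⟨rfl, h⟩
    by_cases h0 : r = 0
    · simp [h0]
    · rw [h h0]

namespace IsSimplePresentation

variable {P : Set E} {f : Facet P → E →L[ℝ] ℝ} {c : Facet P → ℝ}

/-- The model `{(z, p) : |z_j| = ℓ_j(p)}` of the moment-angle manifold of the polytope given by the
inequalities `0 ≤ ℓ_j`. -/
def model (P : Set E) (f : Facet P → E →L[ℝ] ℝ) (c : Facet P → ℝ) : Set ((Facet P → ℂ) × E) :=
  {x | x.2 ∈ P ∧ ∀ j, ‖x.1 j‖ = f j x.2 + c j}

theorem torus_mem_model (S : IsSimplePresentation P f c) (t : Facet P → Circle) {p : E}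
    (hp : p ∈ P) : (fun j => (t j : ℂ) * (f j p + c j : ℝ), p) ∈ model P f c := by
  refine ⟨hp, fun j => ?_⟩
  simp only [norm_mul, Circle.norm_coe, one_mul, Complex.norm_real, Real.norm_eq_abs]
  exact abs_of_nonneg (S.mem_iff.mp hp j)

/-- The product `t j * ℓ j(p)` forgets `t j` exactly where `ℓ j(p) = 0`, that is, on the facet `j`.
In this model the coordinates of `σ` are normal coordinates along the face. -/
theorem exists_homeomorph_model (S : IsSimplePresentation P f c) :
    ∃ e : MomentAngleManifold P ≃ₜ model P f c, ∀ t p,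
      (e (.mk t p) : (Facet P → ℂ) × E) = (fun j => (t j : ℂ) * (f j p + c j : ℝ), (p : E)) := by
  refine (MomentAngleManifold.exists_homeomorph S.isCompact
    (fun x => (⟨_, S.torus_mem_model x.1 x.2.2⟩ : model P f c)) ?_ ?_ ?_).imp
    fun e he t p => congrArg Subtype.val (he t p)
  · refine Continuous.subtype_mk (.prodMk (continuous_pi fun j => ?_) (by fun_prop)) _
    fun_prop
  · rintro ⟨⟨z, p⟩, hp, hz⟩
    choose t ht using fun j => exists_circle_mul_norm (z j)
    refine ⟨(t, ⟨p, hp⟩), Subtype.ext (Prod.ext (funext fun j => ?_) rfl)⟩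
    exact (congrArg (fun r : ℝ => (t j : ℂ) * r) (hz j).symm).trans (ht j)
  · intro t p s q
    have hnn := fun (p : P) j => S.mem_iff.mp p.2 j
    rw [Subtype.mk.injEq, Prod.mk.injEq, and_comm, ← Subtype.ext_iff]
    refine and_congr_right ?_
    rintro rfl
    rw [funext_iff]
    refine forall_congr' fun j => ?_
    rw [circle_mul_eq_iff (hnn p j) (hnn p j), S.mem_facet_iff]
    simp

variable [Fintype (Facet P)] [CompleteSpace E]

/-- The coordinates of a barycentric system identify the moment-angle manifold of `P` with the
moment-angle-complex of its nerve. -/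
theorem exists_homeomorph_complex (S : IsSimplePresentation P f c) {b : Finset (Facet P) → E}
    (h : IsBarycentricSystem P f c (faceFamily f c) b) :
    ∃ Θ : MomentAngleManifold P ≃ₜ MomentAngleComplex (nerveComplex P),
      ∀ t, ∀ u ∈ layerDomain (faceFamily f c), ∀ hp : layerIntegral b u ∈ P, ∀ j,
        (Θ (.mk t ⟨layerIntegral b u, hp⟩) : Facet P → ℂ) j = t j * (1 - u j : ℝ) := by
  have : CompactSpace (layerDomain (faceFamily f c)) :=
    isCompact_iff_compactSpace.mp (isCompact_layerDomain _)
  let κ : layerDomain (faceFamily f c) ≃ₜ P :=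
    Continuous.homeoOfEquivCompactToT2 (f := h.bijOn.equiv) (by
      refine Continuous.subtype_mk (f := fun u : layerDomain (faceFamily f c) =>
        layerIntegral b (u : Facet P → ℝ)) ?_ _
      exact continuous_layerIntegral continuous_const continuous_subtype_val)
  have hκ : ∀ u, (κ u : E) = layerIntegral b (u : Facet P → ℝ) := fun _ => rfl
  have hnn : ∀ (u : layerDomain (faceFamily f c)) j, 0 ≤ 1 - (u : Facet P → ℝ) j :=
    fun u j => sub_nonneg.mpr (u.2.1 j).2
  have hmem : ∀ (t : Facet P → Circle) (u : layerDomain (faceFamily f c)),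
      (fun j => (t j : ℂ) * (1 - (u : Facet P → ℝ) j : ℝ)) ∈ MomentAngleComplex (nerveComplex P) := by
    rintro t ⟨u, hu, τ, hτ, h0⟩
    refine ⟨τ, fun hne => S.mem_nerveComplex_iff.mpr ⟨hne, hτ⟩, fun j _ => ?_, fun j hj => ?_⟩
    · rw [norm_mul, Circle.norm_coe, one_mul, Complex.norm_real, Real.norm_eq_abs, abs_le]
      constructor <;> linarith [(hu j).1, (hu j).2]
    · simp [h0 j hj, Circle.norm_coe]
  refine (MomentAngleManifold.exists_homeomorph S.isCompact
    (fun x => (⟨_, hmem x.1 (κ.symm x.2)⟩ : MomentAngleComplex (nerveComplex P))) ?_ ?_ ?_).imp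
    fun Θ hΘ t u hu hp j => ?_
  rotate_left 3
  · have h1 : κ.symm ⟨layerIntegral b u, hp⟩ = ⟨u, hu⟩ := by
      rw [Homeomorph.symm_apply_eq]
      exact Subtype.ext (hκ ⟨u, hu⟩).symm
    rw [hΘ, h1]
  · refine Continuous.subtype_mk (continuous_pi fun j => ?_) _
    have h1 : Continuous fun x : (Facet P → Circle) × P => (κ.symm x.2 : Facet P → ℝ) j :=
      (continuous_apply j).comp (continuous_subtype_val.comp (κ.symm.continuous.comp continuous_snd))
    fun_prop
  · rintro ⟨z, τ, hτ, hz1, hz2⟩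
    have hle : ∀ j, ‖z j‖ ≤ 1 := fun j => by
      by_cases hj : j ∈ τ
      · exact hz1 j hj
      · exact (hz2 j hj).le
    choose t ht using fun j => exists_circle_mul_norm (z j)
    have hτ' : τ ∈ faceFamily f c := by
      rcases τ.eq_empty_or_nonempty with rfl | hne
      · exact S.empty_mem
      · exact (S.mem_nerveComplex_iff.mp (hτ hne)).2
    -- The support of `u` lies in `τ` because `‖z j‖ = 1` outside `τ`.
    let u : layerDomain (faceFamily f c) := ⟨fun j => 1 - ‖z j‖, fun j =>
      ⟨sub_nonneg.mpr (hle j), by linarith [norm_nonneg (z j)]⟩, τ, hτ', fun j hj => by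
        simp [hz2 j hj]⟩
    refine ⟨(t, κ u), Subtype.ext (funext fun j => ?_)⟩
    refine Eq.trans ?_ (ht j)
    simp [u]
  · intro t p s q
    rw [Subtype.mk.injEq, funext_iff]
    simp only [circle_mul_eq_iff (hnn _ _) (hnn _ _)]
    have hp : ∀ (p : P) j, 1 - (κ.symm p : Facet P → ℝ) j ≠ 0 ↔ (p : E) ∉ (j : Set E) := by
      intro p j
      have h1 := h.layerIntegral_eq_zero_iff (κ.symm p).2 j
      rw [← hκ, κ.apply_symm_apply] at h1
      rw [S.mem_facet_iff, and_iff_right p.2, h1, sub_ne_zero, ne_comm]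
    simp only [hp, forall_and]
    refine and_congr_left fun _ => ⟨fun h1 => ?_, ?_⟩
    · refine κ.symm.injective (Subtype.ext (funext fun j => ?_))
      linarith [h1 j]
    · rintro rfl j
      rfl

end IsSimplePresentation

end Models

/-! ### Moving a face off the boundary -/

section Push

open Set Filter Topology

/-- A homeomorphism which moves the centre of a ball to a point near the centre and fixes all points
outside the ball. -/
theorem exists_push {W : Type} [NormedAddCommGroup W] [NormedSpace ℝ W] [CompleteSpace W] {a : W}
    {ε : ℝ} (hε : 0 < ε) (ha : ‖a‖ ≤ ε / 2) :
    ∃ A : W ≃ₜ W, A 0 = a ∧ ∀ y, ε ≤ ‖y‖ → A y = y := by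
  -- The perturbation of the identity has Lipschitz constant at most `‖a‖ / ε ≤ 1 / 2`, hence `A` is
  -- a homeomorphism.
  let A : W → W := fun y => y + max 0 (1 - ‖y‖ / ε) • a
  have hA : ApproximatesLinearOn A ((ContinuousLinearEquiv.refl ℝ W : W ≃L[ℝ] W) : W →L[ℝ] W) univ
      (1 / 2) := by
    intro x _ y _
    have h1 : A x - A y - (ContinuousLinearEquiv.refl ℝ W : W →L[ℝ] W) (x - y) =
        (max 0 (1 - ‖x‖ / ε) - max 0 (1 - ‖y‖ / ε)) • a := by
      simp only [A, ContinuousLinearEquiv.coe_refl, ContinuousLinearMap.id_apply]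
      module
    have h2 : |max 0 (1 - ‖x‖ / ε) - max 0 (1 - ‖y‖ / ε)| ≤ ‖x - y‖ / ε := by
      rw [max_comm 0, max_comm 0]
      refine (abs_max_sub_max_le_abs _ _ 0).trans ?_
      have h3 : 1 - ‖x‖ / ε - (1 - ‖y‖ / ε) = (‖y‖ - ‖x‖) / ε := by ring
      rw [h3, abs_div, abs_of_pos hε, abs_sub_comm]
      gcongr
      exact abs_norm_sub_norm_le x y
    rw [h1, norm_smul, Real.norm_eq_abs]
    calc _ ≤ ‖x - y‖ / ε * (ε / 2) := by gcongr
      _ = ((1 / 2 : NNReal) : ℝ) * ‖x - y‖ := by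
        push_cast
        field_simp
  have hc : Subsingleton W ∨ (1 / 2 : NNReal) <
      ‖((ContinuousLinearEquiv.refl ℝ W : W ≃L[ℝ] W).symm : W →L[ℝ] W)‖₊⁻¹ := by
    rcases subsingleton_or_nontrivial W with h | h
    · exact Or.inl h
    · right
      have : ‖((ContinuousLinearEquiv.refl ℝ W : W ≃L[ℝ] W).symm : W →L[ℝ] W)‖₊ = 1 := by
        simp only [ContinuousLinearEquiv.refl_symm, ContinuousLinearEquiv.coe_refl]
        exact ContinuousLinearMap.nnnorm_id
      rw [this, inv_one]
      exact NNReal.half_lt_self one_ne_zero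
  refine ⟨hA.toHomeomorph A hc, ?_, fun y hy => ?_⟩
  · change A 0 = a
    simp [A]
  · change A y = y
    have : max 0 (1 - ‖y‖ / ε) = 0 := by
      refine max_eq_left ?_
      rw [sub_nonpos, one_le_div hε]
      exact hy
    simp [A, this]

namespace IsSimplePresentation

variable {E : Type} [NormedAddCommGroup E] [NormedSpace ℝ E] [CompleteSpace E] {P : Set E}
  {f : Facet P → E →L[ℝ] ℝ} {c : Facet P → ℝ} [Fintype (Facet P)]

open Classical in
/-- The point of the model over the point with coordinates `v` on the slice at distances `‖y i‖`,
with coordinates `y` for the facets of `σ` and arguments `t` for the other facets. -/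
def tube (f : Facet P → E →L[ℝ] ℝ) (c : Facet P → ℝ) (σ : Finset (Facet P))
    (β : (σ → ℝ) → Finset (Facet P) → E) (y : σ → ℂ) (t : Facet P → Circle) (v : Facet P → ℝ) :
    (Facet P → ℂ) × E :=
  let p := layerIntegral (β fun i => ‖y i‖) v
  (fun j => if h : j ∈ σ then y ⟨j, h⟩ else (t j : ℂ) * (f j p + c j : ℝ), p)

omit [CompleteSpace E] in
theorem continuous_tube {σ : Finset (Facet P)} {β : (σ → ℝ) → Finset (Facet P) → E}
    (hβ : Continuous β) :
    Continuous fun x : (σ → ℂ) × (Facet P → Circle) × (Facet P → ℝ) =>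
      tube f c σ β x.1 x.2.1 x.2.2 := by
  have h1 : Continuous fun x : (σ → ℂ) × (Facet P → Circle) × (Facet P → ℝ) =>
      layerIntegral (β fun i => ‖x.1 i‖) x.2.2 :=
    continuous_layerIntegral (hβ.comp (by fun_prop)) (by fun_prop)
  refine Continuous.prodMk (continuous_pi fun j => ?_) h1
  by_cases hj : j ∈ σ
  · simp only [hj, dif_pos]
    fun_prop
  · simp only [hj, dif_neg, not_false_eq_true]
    fun_prop

/-- Barycentric systems on the slices at distance at most `ε` from a face. -/
structure IsSliceSystem (P : Set E) [Fintype (Facet P)] (f : Facet P → E →L[ℝ] ℝ) (c : Facet P → ℝ)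
    (σ : Finset (Facet P)) (ε : ℝ) (β : (σ → ℝ) → Finset (Facet P) → E) : Prop where
  pos : 0 < ε
  continuous : Continuous β
  system : ∀ s : σ → ℝ, (∀ i, 0 ≤ s i) → (∀ i, s i ≤ ε) →
    IsBarycentricSystem (slice P f c σ s) (offLinear f σ) (offConst c σ)
      (linkFamily (faceFamily f c) σ) (β s)

namespace IsSliceSystem

variable {σ : Finset (Facet P)} {ε : ℝ} {β : (σ → ℝ) → Finset (Facet P) → E}

omit [CompleteSpace E] in
theorem system_norm (B : IsSliceSystem P f c σ ε β) {y : σ → ℂ} (hy : ‖y‖ ≤ ε) :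
    IsBarycentricSystem (slice P f c σ fun i => ‖y i‖) (offLinear f σ) (offConst c σ)
      (linkFamily (faceFamily f c) σ) (β fun i => ‖y i‖) :=
  B.system _ (fun _ => norm_nonneg _) fun i => (norm_le_pi_norm y i).trans hy

theorem tube_mem (S : IsSimplePresentation P f c) (B : IsSliceSystem P f c σ ε β) {y : σ → ℂ}
    (hy : ‖y‖ ≤ ε) (t : Facet P → Circle) {v : Facet P → ℝ}
    (hv : v ∈ layerDomain (linkFamily (faceFamily f c) σ)) : tube f c σ β y t v ∈ model P f c := by
  have h := (B.system_norm hy).layerIntegral_mem hv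
  refine ⟨h.1, fun j => ?_⟩
  by_cases hj : j ∈ σ
  · simp only [tube, hj, dif_pos]
    exact (h.2 ⟨j, hj⟩).symm
  · simp only [tube, hj, dif_neg, not_false_eq_true, norm_mul, Circle.norm_coe, one_mul,
      Complex.norm_real, Real.norm_eq_abs]
    exact abs_of_nonneg (S.mem_iff.mp h.1 j)

/-- The tube covers the part of the model where the coordinates of `σ` are at most `ε`: the point of
`P` lies on the slice at distances `‖x.1 i‖`, which the layer integral covers. -/
theorem exists_tube_eq (B : IsSliceSystem P f c σ ε β)
    {x : (Facet P → ℂ) × E} (hx : x ∈ model P f c) (hxσ : ∀ i ∈ σ, ‖x.1 i‖ ≤ ε) :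
    ∃ y : σ → ℂ, ‖y‖ ≤ ε ∧ ∃ t, ∃ v ∈ layerDomain (linkFamily (faceFamily f c) σ),
      tube f c σ β y t v = x := by
  have hy : ‖fun i : σ => x.1 i‖ ≤ ε :=
    (pi_norm_le_iff_of_nonneg B.pos.le).mpr fun i => hxσ i i.2
  obtain ⟨v, hv, hvx⟩ := (B.system_norm hy).surjOn ⟨hx.1, fun i => (hx.2 i).symm⟩
  choose t ht using fun j => exists_circle_mul_norm (x.1 j)
  refine ⟨fun i => x.1 i, hy, t, v, hv, Prod.ext (funext fun j => ?_) hvx⟩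
  by_cases hj : j ∈ σ
  · simp only [tube, hj, dif_pos]
  · simp only [tube, hj, dif_neg, not_false_eq_true]
    rw [hvx, ← hx.2 j]
    exact ht j

/-- The point determines `y` and `v`, and for `j ∉ σ` the argument `t j` is lost exactly when `v j =
1`. This condition does not involve `y`, so a self-map of the normal disc descends to the tube. -/
theorem tube_congr (S : IsSimplePresentation P f c) (B : IsSliceSystem P f c σ ε β)
    {y y' z : σ → ℂ} (hy : ‖y‖ ≤ ε)
    (hy' : ‖y'‖ ≤ ε) (hz : ‖z‖ ≤ ε) {t t' : Facet P → Circle} {v v' : Facet P → ℝ}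
    (hv : v ∈ layerDomain (linkFamily (faceFamily f c) σ))
    (hv' : v' ∈ layerDomain (linkFamily (faceFamily f c) σ))
    (h : tube f c σ β y t v = tube f c σ β y' t' v') :
    y = y' ∧ tube f c σ β z t v = tube f c σ β z t' v' := by
  have hfst := fun j => congrFun (congrArg Prod.fst h) j
  have hsnd : layerIntegral (β fun i => ‖y i‖) v = layerIntegral (β fun i => ‖y' i‖) v' :=
    congrArg Prod.snd h
  obtain rfl : y = y' := by
    ext i
    simpa [tube] using hfst i
  obtain rfl : v = v' := (B.system_norm hy).injOn hv hv' hsnd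
  refine ⟨rfl, Prod.ext (funext fun j => ?_) rfl⟩
  by_cases hj : j ∈ σ
  · simp [tube, hj]
  have hS := B.system_norm hy
  have h1 := hfst j
  have hnn := S.mem_iff.mp (hS.layerIntegral_mem hv).1 j
  simp only [tube, hj, dif_neg, not_false_eq_true] at h1 ⊢
  rw [circle_mul_eq_iff hnn hnn] at h1
  have hnn' := S.mem_iff.mp ((B.system_norm hz).layerIntegral_mem hv).1 j
  rw [circle_mul_eq_iff hnn' hnn']
  refine ⟨rfl, fun hne => h1.2 fun h0 => hne ?_⟩
  have e1 := hS.layerIntegral_eq_zero_iff hv j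
  have e2 := (B.system_norm hz).layerIntegral_eq_zero_iff hv j
  rw [off_of_notMem hj] at e1 e2
  exact e2.mpr (e1.mp h0)

/-- Every continuous self-map of the normal disc which fixes its boundary extends to the model. -/
theorem exists_extension (S : IsSimplePresentation P f c) (B : IsSliceSystem P f c σ ε β)
    {A : (σ → ℂ) → σ → ℂ} (hA : Continuous A) (hAε : ∀ y, ‖y‖ ≤ ε → ‖A y‖ ≤ ε)
    (hfix : ∀ y, ε ≤ ‖y‖ → A y = y) :
    ∃ γ : model P f c → model P f c, Continuous γ ∧
      (∀ x, (∃ i ∈ σ, ε ≤ ‖x.1.1 i‖) → γ x = x) ∧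
      ∀ x y t v, ‖y‖ ≤ ε → v ∈ layerDomain (linkFamily (faceFamily f c) σ) →
        x.1 = tube f c σ β y t v → (γ x).1 = tube f c σ β (A y) t v := by
  let L := layerDomain (linkFamily (faceFamily f c) σ)
  have : CompactSpace L := isCompact_iff_compactSpace.mp (isCompact_layerDomain _)
  have hM : IsCompact (model P f c) := by
    have := MomentAngleManifold.compactSpace S.isCompact
    obtain ⟨e, -⟩ := S.exists_homeomorph_model
    exact isCompact_iff_compactSpace.mpr e.compactSpace
  have : CompactSpace (model P f c) := isCompact_iff_compactSpace.mp hM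
  let R : Set (model P f c) := {x | ∃ i ∈ σ, ε ≤ ‖x.1.1 i‖}
  have hR : IsClosed R := by
    have : R = ⋃ i ∈ σ, {x : model P f c | ε ≤ ‖x.1.1 i‖} := by
      ext x
      simp [R]
    rw [this]
    refine σ.finite_toSet.isClosed_biUnion fun i _ => isClosed_le continuous_const ?_
    exact ((continuous_apply i).comp (continuous_fst.comp continuous_subtype_val)).norm
  have : CompactSpace R := isCompact_iff_compactSpace.mp hR.isCompact
  let D := Metric.closedBall (0 : σ → ℂ) ε
  have hD : ∀ y : D, ‖(y : σ → ℂ)‖ ≤ ε := fun y => mem_closedBall_zero_iff.mp y.2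
  let q : D × (Facet P → Circle) × L → model P f c := fun x =>
    ⟨tube f c σ β x.1 x.2.1 x.2.2, tube_mem S B (hD x.1) _ x.2.2.2⟩
  have hq : Continuous q := by
    refine Continuous.subtype_mk ?_ _
    exact (continuous_tube B.continuous).comp
      (f := fun x : D × (Facet P → Circle) × L => ((x.1 : σ → ℂ), x.2.1, (x.2.2 : Facet P → ℝ)))
      (by fun_prop)
  -- The model is a quotient of the parameters of the tube together with the closed part `R` at
  -- distance at least `ε`. Both pieces are compact, so a map is continuous as soon as it is
  -- continuous on each of them.
  let π : (D × (Facet P → Circle) × L) ⊕ R → model P f c := Sum.elim q Subtype.val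
  have hπ : Continuous π := hq.sumElim continuous_subtype_val
  have hπs : Function.Surjective π := by
    intro x
    by_cases hx : x ∈ R
    · exact ⟨Sum.inr ⟨x, hx⟩, rfl⟩
    · simp only [R, mem_ofPred_eq, not_exists, not_and, not_le] at hx
      obtain ⟨y, hy, t, v, hv, h⟩ := B.exists_tube_eq x.2 fun i hi => (hx i hi).le
      exact ⟨Sum.inl (⟨y, mem_closedBall_zero_iff.mpr hy⟩, t, ⟨v, hv⟩), Subtype.ext h⟩
  have hquot : IsQuotientMap (⟨π, hπ⟩ : C(_, _)) := hπ.isClosedMap.isQuotientMap hπ hπs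
  let A' : D → D := fun y => ⟨A y, mem_closedBall_zero_iff.mpr (hAε y (hD y))⟩
  have hA' : Continuous A' := (hA.comp continuous_subtype_val).subtype_mk _
  let π' : (D × (Facet P → Circle) × L) ⊕ R → model P f c :=
    Sum.elim (fun x => q (A' x.1, x.2)) Subtype.val
  have hπ' : Continuous π' := (hq.comp (by fun_prop)).sumElim continuous_subtype_val
  -- Where the pieces overlap, some coordinate of `y` has norm at least `ε`; then so does `y` in the
  -- supremum norm, and `A` fixes it.
  have hmix : ∀ (x : D × (Facet P → Circle) × L) (r : R), q x = r → q (A' x.1, x.2) = r := by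
    rintro ⟨y, t, v⟩ ⟨r, i, hi, hir⟩ h
    have h1 : A' y = y := by
      refine Subtype.ext (hfix y (hir.trans ?_))
      have h0 : r = q (y, t, v) := h.symm
      rw [h0]
      simp only [q, tube, hi, dif_pos]
      exact norm_le_pi_norm (y : σ → ℂ) ⟨i, hi⟩
    rw [h1]
    exact h
  have hfac : ∀ x x', π x = π x' → π' x = π' x' := by
    rintro (⟨y, t, v⟩ | r) (⟨y', t', v'⟩ | r') h
    · obtain ⟨h1, h2⟩ := tube_congr S B (hD y) (hD y') (hD (A' y)) v.2 v'.2
        (congrArg Subtype.val h)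
      obtain rfl : y = y' := Subtype.ext h1
      exact Subtype.ext h2
    · exact hmix _ _ h
    · exact (hmix _ _ h.symm).symm
    · exact h
  let γ := hquot.lift ⟨π', hπ'⟩ hfac
  have hγ : ∀ x, γ (π x) = π' x := fun x =>
    DFunLike.congr_fun (hquot.lift_comp ⟨π', hπ'⟩ hfac) x
  refine ⟨γ, γ.continuous, fun x hx => hγ (Sum.inr ⟨x, hx⟩), fun x y t v hy hv hx => ?_⟩
  have h := hγ (Sum.inl (⟨y, mem_closedBall_zero_iff.mpr hy⟩, t, ⟨v, hv⟩))
  have hx' : x = π (Sum.inl (⟨y, mem_closedBall_zero_iff.mpr hy⟩, t, ⟨v, hv⟩)) := Subtype.ext hx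
  rw [hx', h]
  rfl

/-- The model has a self-homeomorphism which moves the part over the face `σ` to the part over a
parallel slice. -/
theorem exists_homeomorph (S : IsSimplePresentation P f c) (B : IsSliceSystem P f c σ ε β) :
    ∃ γ : model P f c ≃ₜ model P f c, ∀ x t v,
      v ∈ layerDomain (linkFamily (faceFamily f c) σ) → x.1 = tube f c σ β 0 t v →
      (γ x).1 = tube f c σ β (fun _ => (ε / 2 : ℝ)) t v := by
  have hε := B.pos
  obtain ⟨A, hA0, hfix⟩ := exists_push (a := fun _ : σ => ((ε / 2 : ℝ) : ℂ)) hε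
    ((pi_norm_le_iff_of_nonneg (by positivity)).mpr fun i => by
      rw [Complex.norm_real, Real.norm_eq_abs, abs_of_pos (by positivity)])
  have hfix' : ∀ y, ε ≤ ‖y‖ → A.symm y = y := fun y hy => by
    rw [Homeomorph.symm_apply_eq, hfix y hy]
  have hAε : ∀ A : (σ → ℂ) ≃ₜ (σ → ℂ), (∀ y, ε ≤ ‖y‖ → A y = y) → ∀ y, ‖y‖ ≤ ε → ‖A y‖ ≤ ε := by
    intro A hfix y hy
    by_contra! h
    rw [A.injective (hfix _ h.le)] at h
    exact h.not_ge hy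
  obtain ⟨γ, hγ, hγR, hγq⟩ := exists_extension S B A.continuous (hAε A hfix) hfix
  obtain ⟨δ, hδ, hδR, hδq⟩ := exists_extension S B A.symm.continuous (hAε A.symm hfix') hfix'
  -- Stated for an arbitrary `A`, so that exchanging `A` and `A.symm` gives the other composition.
  have hinv : ∀ {γ δ : model P f c → model P f c} (A : (σ → ℂ) ≃ₜ (σ → ℂ)),
      (∀ y, ‖y‖ ≤ ε → ‖A y‖ ≤ ε) →
      (∀ x, (∃ i ∈ σ, ε ≤ ‖x.1.1 i‖) → γ x = x) → (∀ x, (∃ i ∈ σ, ε ≤ ‖x.1.1 i‖) → δ x = x) →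
      (∀ x y t v, ‖y‖ ≤ ε → v ∈ layerDomain (linkFamily (faceFamily f c) σ) →
        x.1 = tube f c σ β y t v → (γ x).1 = tube f c σ β (A y) t v) →
      (∀ x y t v, ‖y‖ ≤ ε → v ∈ layerDomain (linkFamily (faceFamily f c) σ) →
        x.1 = tube f c σ β y t v → (δ x).1 = tube f c σ β (A.symm y) t v) →
      Function.LeftInverse δ γ := by
    intro γ δ A hA hγR hδR hγq hδq x
    by_cases hx : ∃ i ∈ σ, ε ≤ ‖x.1.1 i‖
    · rw [hγR x hx, hδR x hx]
    · push Not at hx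
      obtain ⟨y, hy, t, v, hv, h⟩ := B.exists_tube_eq x.2 fun i hi => (hx i hi).le
      have h1 := hδq (γ x) (A y) t v (hA y hy) hv (hγq x y t v hy hv h.symm)
      rw [A.symm_apply_apply, h] at h1
      exact Subtype.ext h1
  refine ⟨⟨⟨γ, δ, hinv A (hAε A hfix) hγR hδR hγq hδq, hinv A.symm (hAε A.symm hfix') hδR hγR hδq
    (by simpa using hγq)⟩, hγ, hδ⟩, fun x t v hv hx => ?_⟩
  have := hγq x 0 t v (by simpa using hε.le) hv hx
  rw [hA0] at this
  exact this

end IsSliceSystem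

end IsSimplePresentation

end Push

/-! ### The face embedding -/

section FaceEmbedding

open Set Filter Topology

namespace IsSimplePresentation

variable {E : Type} [NormedAddCommGroup E] [NormedSpace ℝ E] [CompleteSpace E] {P : Set E}
  {f : Facet P → E →L[ℝ] ℝ} {c : Facet P → ℝ} [Fintype (Facet P)]

/-- There is a homeomorphism from the moment-angle manifold of `P` to the moment-angle-complex which
sends the point over a face `σ` with the coordinates `v` and the arguments `t`, trivial on `σ`, to the
point with the coordinates `t j * (1 - v j)`. -/
theorem exists_homeomorph_straightening (S : IsSimplePresentation P f c) (σ : Finset (Facet P)) :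
    ∃ (H : MomentAngleManifold P ≃ₜ MomentAngleComplex (nerveComplex P)) (ψ : (Facet P → ℝ) → E),
      BijOn ψ (layerDomain (linkFamily (faceFamily f c) σ)) (faceSet f c σ) ∧
      ∀ t : Facet P → Circle, (∀ j ∈ σ, t j = 1) →
        ∀ v ∈ layerDomain (linkFamily (faceFamily f c) σ), ∀ hp : ψ v ∈ P, ∀ j,
          (H (.mk t ⟨ψ v, hp⟩) : Facet P → ℂ) j = t j * (1 - v j : ℝ) := by
  obtain ⟨ε, hε, β, hβ, hsys⟩ := S.exists_slices σ
  have B : IsSliceSystem P f c σ ε β := ⟨hε, hβ, hsys⟩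
  have hmid := hsys (fun _ => ε / 2) (fun _ => by positivity) fun _ => by linarith
  have hzero := hsys 0 (fun _ => le_rfl) fun _ => hε.le
  -- The system on `P` has its points for the link on the slice at `ε / 2`, so the layer integrals
  -- of `P` and of this slice agree on the link. The homeomorphism is the push `γ`, read in the
  -- model, followed by the coordinates `Θ` of this system.
  obtain ⟨b, hb, hbτ⟩ := S.exists_extension (fun _ => by positivity) hmid
  obtain ⟨Θ, hΘ⟩ := S.exists_homeomorph_complex hb
  obtain ⟨e, he⟩ := S.exists_homeomorph_model
  obtain ⟨γ, hγ⟩ := B.exists_homeomorph S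
  have hslice : slice P f c σ 0 = faceSet f c σ := by
    ext x
    rw [slice, faceSet, mem_ofPred_eq, mem_ofPred_eq, S.mem_iff]
    simp
  refine ⟨e.trans (γ.trans (e.symm.trans Θ)), layerIntegral (β 0), hslice ▸ hzero.bijOn,
    fun t ht v hv hp j => ?_⟩
  have hbv : layerIntegral (β fun _ => ε / 2) v = layerIntegral b v :=
    layerIntegral_congr fun s hs _ => (hbτ _ (superlevel_mem hmid.subset_mem hv hs)).symm
  have hbP : layerIntegral b v ∈ P := by
    rw [← hbv]
    exact (hmid.layerIntegral_mem hv).1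
  have h0 : (e (.mk t ⟨layerIntegral (β 0) v, hp⟩)).1 = tube f c σ β 0 t v := by
    have h00 : (fun i : σ => ‖(0 : σ → ℂ) i‖) = 0 := by
      ext
      simp
    rw [he]
    refine Prod.ext (funext fun j => ?_) (by simp only [tube, h00])
    by_cases hj : j ∈ σ
    · have := (hzero.layerIntegral_mem hv).2 ⟨j, hj⟩
      simp only at this
      simp [tube, hj, this]
    · simp only [tube, hj, dif_neg, not_false_eq_true, h00]
  have h1 : γ (e (.mk t ⟨layerIntegral (β 0) v, hp⟩)) = e (.mk t ⟨layerIntegral b v, hbP⟩) := by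
    have hn : (fun _ : σ => ‖((ε / 2 : ℝ) : ℂ)‖) = fun _ => ε / 2 := by
      ext
      rw [Complex.norm_real, Real.norm_eq_abs, abs_of_pos (by positivity)]
    refine Subtype.ext ((hγ _ t v hv h0).trans ?_)
    rw [he]
    refine Prod.ext (funext fun j => ?_) (by simp only [tube, hn, hbv])
    by_cases hj : j ∈ σ
    · have := (hmid.layerIntegral_mem hv).2 ⟨j, hj⟩
      rw [hbv] at this
      simp only at this
      -- The pushed point has the positive real coordinate `ε / 2` here, which is the point with
      -- argument `t j = 1`.
      simp [tube, hj, this, ht j hj]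
    · simp only [tube, hj, dif_neg, not_false_eq_true, hn, hbv]
  have h2 : (e.trans (γ.trans (e.symm.trans Θ))) (.mk t ⟨layerIntegral (β 0) v, hp⟩) =
      Θ (.mk t ⟨layerIntegral b v, hbP⟩) := by
    simp only [Homeomorph.trans_apply, h1, Homeomorph.symm_apply_apply]
  rw [h2]
  exact hΘ t v (layerDomain_mono linkFamily_subset hv) hbP j

end IsSimplePresentation

/-- Forgetting the coordinates outside the image of a full subcomplex. -/
theorem restrict_mem_momentAngleComplex {V W : Type} {K : PreAbstractSimplicialComplex V}
    {L : PreAbstractSimplicialComplex W} {φ : V → W} (hφ : Function.Injective φ)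
    (hfull : imageComplex φ K = fullSubcomplex L (range φ)) {z : W → ℂ}
    (hz : z ∈ MomentAngleComplex L) : z ∘ φ ∈ MomentAngleComplex K := by
  classical
  obtain ⟨τ, hτ, h1, h2⟩ := hz
  have hfin : (φ ⁻¹' (τ : Set W)).Finite := τ.finite_toSet.preimage hφ.injOn
  refine ⟨hfin.toFinset, fun hne => ?_, fun i hi => h1 _ (by simpa using hi),
    fun i hi => h2 _ (by simpa using hi)⟩
  have hne' : (hfin.toFinset.image φ).Nonempty := hne.image φ
  have hsub : hfin.toFinset.image φ ⊆ τ := by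
    intro j hj
    obtain ⟨i, hi, rfl⟩ := Finset.mem_image.mp hj
    simpa using hi
  have hmem : hfin.toFinset.image φ ∈ fullSubcomplex L (range φ) :=
    ⟨(L.isRelLowerSet_faces (hτ (hne'.mono hsub))).2 hsub hne', by
      intro j hj
      obtain ⟨i, -, rfl⟩ := Finset.mem_image.mp (Finset.mem_coe.mp hj)
      exact mem_range_self i⟩
  rw [← hfull] at hmem
  obtain ⟨ρ, hρ, h⟩ := hmem
  have : ρ = hfin.toFinset := by
    refine Finset.image_injective hφ ?_
    simpa [Finset.ext_iff] using h
  rwa [← this]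

/-- The retraction of the map of moment-angle-complexes induced by a full subcomplex. -/
def MomentAngleComplex.restrict {V W : Type} {K : PreAbstractSimplicialComplex V}
    {L : PreAbstractSimplicialComplex W} {φ : V → W} (hφ : Function.Injective φ)
    (hfull : imageComplex φ K = fullSubcomplex L (range φ)) :
    C(MomentAngleComplex L, MomentAngleComplex K) where
  toFun z := ⟨(z : W → ℂ) ∘ φ, restrict_mem_momentAngleComplex hφ hfull z.2⟩
  continuous_toFun := Continuous.subtype_mk ((Pi.continuous_precomp φ).comp
    continuous_subtype_val) _

theorem MomentAngleComplex.restrict_map {V W : Type} {K : PreAbstractSimplicialComplex V}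
    {L : PreAbstractSimplicialComplex W} {φ : V → W} (hφ : IsSimplicialEmbedding K L φ)
    (hfull : imageComplex φ K = fullSubcomplex L (range φ)) (z : MomentAngleComplex K) :
    MomentAngleComplex.restrict hφ.injective hfull (MomentAngleComplex.map hφ z) = z :=
  Subtype.ext (funext fun i => hφ.injective.extend_apply (z : V → ℂ) 1 i)

theorem MomentAngleComplex.map_restrict {V W : Type} {K : PreAbstractSimplicialComplex V}
    {L : PreAbstractSimplicialComplex W} {φ : V → W} (hφ : IsSimplicialEmbedding K L φ)
    (hfull : imageComplex φ K = fullSubcomplex L (range φ)) {z : MomentAngleComplex L}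
    (hz : ∀ j ∉ range φ, (z : W → ℂ) j = 1) :
    MomentAngleComplex.map hφ (MomentAngleComplex.restrict hφ.injective hfull z) = z := by
  refine Subtype.ext (funext fun j => ?_)
  by_cases hj : j ∈ range φ
  · obtain ⟨i, rfl⟩ := hj
    exact hφ.injective.extend_apply ((z : W → ℂ) ∘ φ) 1 i
  · exact (Function.extend_apply' _ _ _ hj).trans (hz j hj).symm

open CategoryTheory Simplicial in
/-- A retraction induces a splitting in cohomology. -/
theorem isSplitEpi_singularCohomologyMap {X Y : Type} [TopologicalSpace X] [TopologicalSpace Y]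
    (i : C(X, Y)) (ρ : C(Y, X)) (h : ρ.comp i = ContinuousMap.id X) (R : Type*) [CommRing R] :
    (singularCohomologyMap R i).IsSplitEpi := by
  refine ⟨singularCohomologyMap R ρ, fun p x => ?_⟩
  have hcomp : CategoryStruct.comp (TopCat.toSSet.map (TopCat.ofHom i))
      (TopCat.toSSet.map (TopCat.ofHom ρ)) = CategoryStruct.id _ := by
    rw [← CategoryTheory.Functor.map_comp, ← TopCat.ofHom_comp, h, TopCat.ofHom_id,
      CategoryTheory.Functor.map_id]
  induction x using Submodule.Quotient.induction_on with | _ g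
  refine congrArg Submodule.Quotient.mk (Subtype.ext (funext fun y => ?_))
  have h1 := congrArg (fun θ : singularSet X ⟶ singularSet X => θ.app (Opposite.op ⦋p⦌) y) hcomp
  exact congrArg (g : Cochain R _ p) h1

namespace IsSimplePresentation

variable {E : Type} [NormedAddCommGroup E] [NormedSpace ℝ E] [CompleteSpace E] {P : Set E}
  {f : Facet P → E →L[ℝ] ℝ} {c : Facet P → ℝ} [Fintype (Facet P)]

open Classical in
/-- If the facet map of a face identifies the nerve of the face with a full subcomplex, then the face
embedding is conjugate to the map of moment-angle-complexes. -/
theorem exists_conjugation (S : IsSimplePresentation P f c) {σ : Finset (Facet P)}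
    (hFP : faceSet f c σ ⊆ P) {φ : Facet (faceSet f c σ) → Facet P}
    (hφ : IsFacetMap P (faceSet f c σ) φ)
    (hrange : ∀ j, j ∈ range φ ↔ j ∉ σ ∧ insert j σ ∈ faceFamily f c)
    (hlink : ∀ τ ∈ faceFamily f c, (τ : Set (Facet P)) ⊆ range φ → τ ∪ σ ∈ faceFamily f c) :
    ∃ (H₁ : MomentAngleManifold (faceSet f c σ) ≃ₜ
        MomentAngleComplex (nerveComplex (faceSet f c σ)))
      (H₂ : MomentAngleManifold P ≃ₜ MomentAngleComplex (nerveComplex P)),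
      ∀ z, H₂ (faceEmbedding hFP hφ z) =
        MomentAngleComplex.map hφ.isSimplicialEmbedding (H₁ z) := by
  obtain ⟨H, ψ, hψ, hH⟩ := S.exists_homeomorph_straightening σ
  have hemb := hφ.isSimplicialEmbedding
  have hfull := S.imageComplex_eq hφ hlink
  have hext : ∀ (t : Facet (faceSet f c σ) → Circle) j, j ∉ range φ → Function.extend φ t 1 j = 1 :=
    fun t j hj => Function.extend_apply' _ _ _ hj
  have hσ : ∀ j ∈ σ, j ∉ range φ := fun j hj h => ((hrange j).mp h).1 hj
  -- Every vertex of the link of `σ` is in the range of `φ`, so the coordinates `v` vanish off this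
  -- range.
  have hsupp : ∀ v ∈ layerDomain (linkFamily (faceFamily f c) σ), ∀ j ∉ range φ, v j = 0 := by
    rintro v ⟨-, τ, hτ, h0⟩ j hj
    refine h0 j fun hjτ => hj ((hrange j).mpr ⟨Finset.disjoint_left.mp hτ.1 hjτ, ?_⟩)
    refine faceFamily_of_subset (Finset.insert_subset ?_ Finset.subset_union_right) hτ.2
    exact Finset.mem_union_left _ hjτ
  have hval : ∀ (t : Facet (faceSet f c σ) → Circle),
      ∀ v ∈ layerDomain (linkFamily (faceFamily f c) σ), ∀ hp : ψ v ∈ faceSet f c σ, ∀ j,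
        (H (faceEmbedding hFP hφ (.mk t ⟨ψ v, hp⟩)) : Facet P → ℂ) j =
          (Function.extend φ t 1 j : Circle) * (1 - v j : ℝ) :=
    fun t v hv hp j => hH _ (fun j hj => hext t j (hσ j hj)) v hv (hFP hp) j
  have hmem : ∀ x, ∀ j ∉ range φ, (H (faceEmbedding hFP hφ x) : Facet P → ℂ) j = 1 := by
    intro x j hj
    obtain ⟨t, ⟨p, hp⟩, rfl⟩ := MomentAngleManifold.exists_mk x
    obtain ⟨v, hv, rfl⟩ := hψ.surjOn hp
    rw [hval t v hv, hext t j hj, hsupp v hv j hj]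
    simp
  have hsurj : ∀ w : MomentAngleComplex (nerveComplex P), (∀ j ∉ range φ, (w : Facet P → ℂ) j = 1) →
      ∃ x, H (faceEmbedding hFP hφ x) = w := by
    rintro ⟨w, τ, hτ, hw1, hw2⟩ hw
    choose t ht using fun j => exists_circle_mul_norm (w j)
    have hτ' : τ ∈ faceFamily f c := by
      rcases τ.eq_empty_or_nonempty with rfl | hne
      · exact S.empty_mem
      · exact (S.mem_nerveComplex_iff.mp (hτ hne)).2
    have hle : ∀ j, ‖w j‖ ≤ 1 := fun j => by
      by_cases hj : j ∈ τ
      · exact hw1 j hj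
      · exact (hw2 j hj).le
    -- The support lies in the part of `τ` in the range of `φ`, and by `hlink` this part is in the
    -- link of `σ`.
    have hv : (fun j => 1 - ‖w j‖) ∈ layerDomain (linkFamily (faceFamily f c) σ) := by
      refine ⟨fun j => ⟨sub_nonneg.mpr (hle j), by linarith [norm_nonneg (w j)]⟩,
        τ.filter (· ∈ range φ), ⟨?_, hlink _ (faceFamily_of_subset (Finset.filter_subset _ _) hτ')
          fun j hj => (Finset.mem_filter.mp hj).2⟩, fun j hj => ?_⟩
      · exact Finset.disjoint_left.mpr fun j hj hjσ => hσ j hjσ (Finset.mem_filter.mp hj).2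
      · rw [Finset.mem_filter, not_and_or] at hj
        rcases hj with hj | hj
        · simp [hw2 j hj]
        · have := hw j hj
          simp only at this
          simp [this]
    refine ⟨.mk (t ∘ φ) ⟨_, hψ.mapsTo hv⟩, Subtype.ext (funext fun j => ?_)⟩
    rw [hval _ _ hv]
    refine Eq.trans ?_ (ht j)
    by_cases hj : j ∈ range φ
    · obtain ⟨G, rfl⟩ := hj
      rw [hemb.injective.extend_apply]
      simp
    · have h1 := hw j hj
      have h2 := ht j
      simp only at h1
      rw [h1] at h2
      rw [hext _ j hj, h1]
      simpa using h2.symm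
  have hinj : Function.Injective (faceEmbedding hFP hφ) := by
    intro x y hxy
    obtain ⟨t, p, rfl⟩ := MomentAngleManifold.exists_mk x
    obtain ⟨s, q, rfl⟩ := MomentAngleManifold.exists_mk y
    obtain ⟨h1, h2⟩ := MomentAngleManifold.mk_eq_mk_iff.mp
      (show MomentAngleManifold.mk (Function.extend φ t 1) (inclusion hFP p) =
        MomentAngleManifold.mk (Function.extend φ s 1) (inclusion hFP q) from hxy)
    refine MomentAngleManifold.mk_eq_mk_iff.mpr ⟨inclusion_injective hFP h1, fun G hG => ?_⟩
    have h3 := h2 (φ G) fun h => hG (by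
      rw [hφ G]
      exact ⟨p.2, h⟩)
    rwa [hemb.injective.extend_apply, hemb.injective.extend_apply] at h3
  let r := MomentAngleComplex.restrict hemb.injective hfull
  -- The image of `H ∘ faceEmbedding` consists of the points with coordinate `1` off the range of
  -- `φ`, which is the image of the map of complexes. Forgetting these coordinates therefore gives a
  -- bijection, and `H₁` needs no separate system on the face.
  let h₁ : MomentAngleManifold (faceSet f c σ) → MomentAngleComplex (nerveComplex (faceSet f c σ)) :=
    fun x => r (H (faceEmbedding hFP hφ x))
  have hmap : ∀ x, MomentAngleComplex.map hemb (h₁ x) = H (faceEmbedding hFP hφ x) :=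
    fun x => MomentAngleComplex.map_restrict hemb hfull (hmem x)
  have hbij : Function.Bijective h₁ := by
    constructor
    · intro x y hxy
      have := congrArg (MomentAngleComplex.map hemb) hxy
      rw [hmap, hmap] at this
      exact hinj (H.injective this)
    · intro w
      obtain ⟨x, hx⟩ := hsurj (MomentAngleComplex.map hemb w) fun j hj =>
        Function.extend_apply' _ _ _ hj
      refine ⟨x, ?_⟩
      change r (H _) = w
      rw [hx]
      exact MomentAngleComplex.restrict_map hemb hfull w
  have hcont : Continuous h₁ := by fun_prop
  have := MomentAngleManifold.compactSpace (S.isCompact_faceSet σ)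
  exact ⟨Continuous.homeoOfEquivCompactToT2 (f := Equiv.ofBijective h₁ hbij) hcont, H,
    fun x => (hmap x).symm⟩

end IsSimplePresentation

end FaceEmbedding

end

theorem lemma2p10 {n : ℕ} (P F : Set (EuclideanSpace ℝ (Fin n))) (hP : IsSimplePolytope P)
    (hflag : IsFlagComplex (nerveComplex P)) (hF : IsFace P F) :
    ∃ (φ : Facet F → Facet P) (hφ : IsFacetMap P F φ),
      -- the facet map `φ` is the only one
      (∀ ψ : Facet F → Facet P, IsFacetMap P F ψ → ψ = φ) ∧
      -- `Φ(K_F)` is the full subcomplex of `K_P` on the vertex set `φ(𝓕(F))`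
      imageComplex φ (nerveComplex F) = fullSubcomplex (nerveComplex P) (Set.range φ) ∧
      -- the maps induced by the face embedding and by `Φ` are conjugate by homeomorphisms
      (∃ (H₁ : MomentAngleManifold F ≃ₜ MomentAngleComplex (nerveComplex F))
        (H₂ : MomentAngleManifold P ≃ₜ MomentAngleComplex (nerveComplex P)),
        ∀ z, H₂ (faceEmbedding hF.2.subset hφ z) =
          MomentAngleComplex.map hφ.isSimplicialEmbedding (H₁ z)) ∧
      -- the map of moment-angle manifolds has a retraction
      (∃ ρ : C(MomentAngleManifold P, MomentAngleManifold F),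
        ρ.comp (faceEmbedding hF.2.subset hφ) = ContinuousMap.id _) ∧
      -- it induces a split ring epimorphism in cohomology, for all coefficient rings
      ∀ (R : Type*) [CommRing R],
        (singularCohomologyMap R (faceEmbedding hF.2.subset hφ)).IsSplitEpi := by
  obtain ⟨hfin, f, c, S⟩ := hP.exists_presentation
  have := Fintype.ofFinite (Facet P)
  obtain ⟨σ, hσ, rfl⟩ := S.exists_eq_faceSet hF
  obtain ⟨φ, hφ, huniq, hrange⟩ := S.exists_facetMap hσ
  -- This is where flagness enters: the link of `σ` is a full subcomplex.
  have hlink : ∀ τ ∈ faceFamily f c, (τ : Set (Facet P)) ⊆ Set.range φ →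
      open Classical in τ ∪ σ ∈ faceFamily f c :=
    fun τ hτ h => S.union_mem_of_flag hflag hσ hτ fun j hj => ((hrange j).mp (h hj)).2
  have hfull := S.imageComplex_eq hφ hlink
  obtain ⟨H₁, H₂, hH⟩ := S.exists_conjugation hF.2.subset hφ hrange hlink
  let ρ : C(MomentAngleManifold P, MomentAngleManifold (faceSet f c σ)) :=
    (H₁.symm : C(_, _)).comp
      ((MomentAngleComplex.restrict hφ.isSimplicialEmbedding.injective hfull).comp (H₂ : C(_, _)))
  have hρ : ρ.comp (faceEmbedding hF.2.subset hφ) = ContinuousMap.id _ := by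
    ext x
    change H₁.symm (MomentAngleComplex.restrict hφ.injective hfull (H₂ (faceEmbedding _ hφ x))) = x
    rw [hH, MomentAngleComplex.restrict_map, H₁.symm_apply_apply]
  exact ⟨φ, hφ, huniq, hfull, ⟨H₁, H₂, hH⟩, ⟨ρ, hρ⟩, fun R _ =>
    isSplitEpi_singularCohomologyMap _ ρ hρ R⟩
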